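/- Let $n\ge 3$, and place $2n$ points on a circle, labelled $1,2,\dots,2n$ clockwise; the odd points are called hollow and the even points solid. Hollow (resp. solid) diagonals join two distinct hollow (resp. solid) points, boundary edges of the hollow (resp. solid) polygon being included. Let $D_\circ$ be a hollow dissection, i.e. a set of pairwise non-crossing internal diagonals of the hollow polygon, and let $\overline{D}_\circ$ be $D_\circ$ together with all boundary edges of the hollow polygon. The cells of $D_\circ$ are the polygons into which $D_\circ$ cuts the hollow polygon. A solid diagonal $\gamma$ is a $D_\circ$-accordion diagonal if the diagonals of $\overline{D}_\circ$ crossed by $\gamma$ form a connected set. Its height $h(\gamma)$ is the number of $D_\circ$-accordion diagonals that cross $\gamma$, and its $g$-vector is $g(\gamma)=\sum_{\delta\in D_\circ}\varepsilon(\delta,\gamma)\,e_\delta\in\mathbb R^{D_\circ}$, where $(e_\delta)_{\delta\in D_\circ}$ is the canonical basis and $\varepsilon(\delta,\gamma)\in\{-1,0,1\}$ is defined as follows. If $\gamma$ does not cross $\delta$, then $\varepsilon(\delta,\gamma)=0$. If $\gamma$ crosses $\delta$, let $\mu$ and $\nu$ be the diagonals of $\overline{D}_\circ$ other than $\delta$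 that are crossed by $\gamma$ in the two cells of $D_\circ$ containing $\delta$. If $\mu,\delta,\nu$ are the successive edges of a path $u,v,w,x$, then $\varepsilon(\delta,\gamma)=1$ when $u,v,x,w$ are in clockwise order (the path is a $\mathsf Z$) and $\varepsilon(\delta,\gamma)=-1$ when $v,u,w,x$ are in clockwise order (the path is an $\mathsf S$); otherwise (if $\mu,\delta,\nu$ share a common endpoint) $\varepsilon(\delta,\gamma)=0$. The $D_\circ$-accordiohedron is the polytope $$\mathrm{Acco}(D_\circ)=\{x\in\mathbb R^{D_\circ} : \langle g(\gamma),x\rangle\le h(\gamma)\text{ for every } D_\circ\text{-accordion diagonal }\gamma\}.$$ Then $\mathrm{Acco}(D_\circ)$ has exactly $|D_\circ|$ unordered pairs of distinct parallel facets. Moreover, these are precisely the pairs $\{F(\gamma),F(\gamma')\}$, where $F(\gamma)=\{x\in\mathrm{Acco}(D_\circ):\langle g(\gamma),x\rangle=h(\gamma)\}$, and $\gamma,\gamma'$ are $D_\circ$-accordion diagonals with $g(\gamma)=e_\delta$ and $g(\gamma')=-e_\delta$ for some $\delta\in D_\circ$. -/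

import Mathlib

open scoped RealInnerProductSpace

/-!
Vertices of the two interlaced polygons. There are `2 * n` points on the circle, labelled clockwise
`1, 2, ..., 2 * n`; the odd labels are the hollow vertices, the even labels the solid ones.
Both families are indexed by `Fin n`. -/

/-- The label `2 i + 1` of the `i`-th hollow vertex. -/
def hollowLabel {n : ℕ} (i : Fin n) : ℕ := 2 * (i : ℕ) + 1

/-- The label `2 i + 2` of the `i`-th solid vertex (right after the `i`-th hollow vertex). -/
def solidLabel {n : ℕ} (i : Fin n) : ℕ := 2 * (i : ℕ) + 2

/-- The four labels `a, b, c, d` are distinct and are met in this cyclic order when the circle is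
traversed clockwise. -/
def Clockwise (a b c d : ℕ) : Prop :=
  (a < b ∧ b < c ∧ c < d) ∨ (b < c ∧ c < d ∧ d < a) ∨
    (c < d ∧ d < a ∧ a < b) ∨ (d < a ∧ a < b ∧ b < c)

/-- Two chords of the circle cross (in their relative interiors): they have four distinct
endpoints, which alternate around the circle. -/
def ChordsCross (e f : Sym2 ℕ) : Prop :=
  ∃ a b c d : ℕ, e = s(a, b) ∧ f = s(c, d) ∧ Clockwise a c b d

/-- A boundary edge of the `n`-gon: it joins a vertex to the next one. -/
def IsBoundaryEdge {n : ℕ} (e : Sym2 (Fin n)) : Prop :=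
  ∃ i : Fin n, e = s(i, finRotate n i)

/-- An internal diagonal of the `n`-gon. -/
def IsInternalDiagonal {n : ℕ} (e : Sym2 (Fin n)) : Prop :=
  ¬ e.IsDiag ∧ ¬ IsBoundaryEdge e

/-- The hollow diagonals `e` and `f` cross. -/
def HollowCross {n : ℕ} (e f : Sym2 (Fin n)) : Prop :=
  ChordsCross (e.map hollowLabel) (f.map hollowLabel)

/-- The solid diagonals `e` and `f` cross. -/
def SolidCross {n : ℕ} (e f : Sym2 (Fin n)) : Prop :=
  ChordsCross (e.map solidLabel) (f.map solidLabel)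

/-- The hollow diagonal `e` and the solid diagonal `g` cross. -/
def HollowSolidCross {n : ℕ} (e g : Sym2 (Fin n)) : Prop :=
  ChordsCross (e.map hollowLabel) (g.map solidLabel)

/-- A hollow dissection: a set of pairwise non-crossing internal diagonals of the hollow
`n`-gon. -/
structure HollowDissection (n : ℕ) where
  diagonals : Finset (Sym2 (Fin n))
  internal : ∀ e ∈ diagonals, IsInternalDiagonal e
  noncrossing : ∀ e ∈ diagonals, ∀ f ∈ diagonals, ¬ HollowCross e f

/-- The path `u - v - w - x`, with edges `m`, `e`, `k`, has the shape of a `Z`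
(the corners of a `Z`, in clockwise order from the upper left one, are `u, v, x, w`). -/
def FormsZ {n : ℕ} (m e k : Sym2 (Fin n)) : Prop :=
  ∃ u v w x : Fin n, m = s(u, v) ∧ e = s(v, w) ∧ k = s(w, x) ∧
    Clockwise (hollowLabel u) (hollowLabel v) (hollowLabel x) (hollowLabel w)

/-- The path `u - v - w - x`, with edges `m`, `e`, `k`, has the shape of an `S`
(the corners of an `S`, in clockwise order from the upper left one, are `v, u, w, x`). -/
def FormsS {n : ℕ} (m e k : Sym2 (Fin n)) : Prop :=
  ∃ u v w x : Fin n, m = s(u, v) ∧ e = s(v, w) ∧ k = s(w, x) ∧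
    Clockwise (hollowLabel v) (hollowLabel u) (hollowLabel w) (hollowLabel x)

/-- A set of non-crossing diagonals is connected: one can go from any of its diagonals to any
other through diagonals of the set, two successive ones having a common endpoint. -/
def ConnectedDiagonals {n : ℕ} (A : Set (Sym2 (Fin n))) : Prop :=
  ∀ e ∈ A, ∀ f ∈ A,
    Relation.ReflTransGen (fun e₁ e₂ => e₁ ∈ A ∧ e₂ ∈ A ∧ ∃ v, v ∈ e₁ ∧ v ∈ e₂) e f

namespace HollowDissection

variable {n : ℕ}

/-- The dissection together with all boundary edges of the hollow polygon. -/
def withBoundary (D : HollowDissection n) : Set (Sym2 (Fin n)) :=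
  {e | e ∈ D.diagonals ∨ IsBoundaryEdge e}

/-- The vertex sets of the cells of the dissection: the maximal sets of vertices of the hollow
polygon no two of which are separated by a diagonal of the dissection. -/
def IsCell (D : HollowDissection n) (C : Set (Fin n)) : Prop :=
  Maximal (fun C : Set (Fin n) =>
    ∀ v ∈ C, ∀ w ∈ C, ∀ e ∈ D.diagonals, ¬ HollowCross s(v, w) e) C

/-- The hollow diagonals (boundary edges included) crossed by the solid diagonal `g`. -/
def crossed (D : HollowDissection n) (g : Sym2 (Fin n)) : Set (Sym2 (Fin n)) :=
  {e | e ∈ D.withBoundary ∧ HollowSolidCross e g}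

/-- The solid diagonal `g` (internal, or a boundary edge of the solid polygon) is an accordion
diagonal: the hollow diagonals that it crosses form a connected set. -/
def IsAccordionDiagonal (D : HollowDissection n) (g : Sym2 (Fin n)) : Prop :=
  ¬ g.IsDiag ∧ ConnectedDiagonals (D.crossed g)

/-- `m` and `k` are the diagonals of `D.withBoundary` other than `e` that are crossed by the solid
diagonal `g` in the two cells having `e` as an edge; moreover `g` crosses `e`. (A diagonal of
`D.withBoundary` is an edge of a cell if and only if both its endpoints are vertices of that
cell.) -/
def Neighbours (D : HollowDissection n) (g m e k : Sym2 (Fin n)) : Prop :=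
  e ∈ D.crossed g ∧ m ∈ D.crossed g ∧ k ∈ D.crossed g ∧ m ≠ e ∧ k ≠ e ∧
    ∃ C C' : Set (Fin n), D.IsCell C ∧ D.IsCell C' ∧ C ≠ C' ∧
      (∀ v ∈ e, v ∈ C) ∧ (∀ v ∈ e, v ∈ C') ∧ (∀ v ∈ m, v ∈ C) ∧ (∀ v ∈ k, v ∈ C')

open Classical in
/-- The coefficient of the `g`-vector of the solid diagonal `g` at the hollow diagonal `e`:
`1` if `g` slaloms on `e` as a `Z`, `-1` if it slaloms on `e` as an `S`, and `0` otherwise. -/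
noncomputable def slalomSign (D : HollowDissection n) (e g : Sym2 (Fin n)) : ℝ :=
  if ∃ m k, D.Neighbours g m e k ∧ FormsZ m e k then 1
  else if ∃ m k, D.Neighbours g m e k ∧ FormsS m e k then -1
  else 0

/-- The `g`-vector of the solid diagonal `g`, in the Euclidean space with one coordinate for each
diagonal of the dissection. -/
noncomputable def gVector (D : HollowDissection n) (g : Sym2 (Fin n)) :
    EuclideanSpace ℝ D.diagonals :=
  WithLp.toLp 2 (fun e => D.slalomSign e.1 g)

/-- The height of `g`: the number of accordion diagonals that cross `g`. -/
noncomputable def height (D : HollowDissection n) (g : Sym2 (Fin n)) : ℕ :=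
  {h : Sym2 (Fin n) | D.IsAccordionDiagonal h ∧ SolidCross h g}.ncard

/-- The half-space of the accordion diagonal `g`. -/
def halfSpace (D : HollowDissection n) (g : Sym2 (Fin n)) :
    Set (EuclideanSpace ℝ D.diagonals) :=
  {x | ⟪D.gVector g, x⟫ ≤ (D.height g : ℝ)}

/-- The bounding hyperplane of the half-space of `g`. -/
def hyperplane (D : HollowDissection n) (g : Sym2 (Fin n)) :
    Set (EuclideanSpace ℝ D.diagonals) :=
  {x | ⟪D.gVector g, x⟫ = (D.height g : ℝ)}

/-- The accordiohedron: the intersection of the half-spaces of all accordion diagonals. -/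
def accordiohedron (D : HollowDissection n) : Set (EuclideanSpace ℝ D.diagonals) :=
  {x | ∀ g, D.IsAccordionDiagonal g → x ∈ D.halfSpace g}

/-- The face of the accordiohedron cut out by the accordion diagonal `g`. -/
def accordiohedronFace (D : HollowDissection n) (g : Sym2 (Fin n)) :
    Set (EuclideanSpace ℝ D.diagonals) :=
  D.accordiohedron ∩ D.hyperplane g

end HollowDissection

/-- A facet of a convex set `P`: a nonempty exposed face whose dimension is one less than the
dimension of `P`. -/
def IsFacet {ι : Type*} [Fintype ι] (P F : Set (EuclideanSpace ℝ ι)) : Prop :=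
  IsExposed ℝ P F ∧ F.Nonempty ∧
    Module.finrank ℝ (vectorSpan ℝ F) + 1 = Module.finrank ℝ (vectorSpan ℝ P)

/-- The unordered pairs of distinct parallel facets of `P`. -/
def parallelFacetPairs {ι : Type*} [Fintype ι] (P : Set (EuclideanSpace ℝ ι)) :
    Set (Sym2 (Set (EuclideanSpace ℝ ι))) :=
  {p | ∃ F G, p = s(F, G) ∧ F ≠ G ∧ IsFacet P F ∧ IsFacet P G ∧
    (affineSpan ℝ F).Parallel (affineSpan ℝ G)}

/-! Write a solid diagonal `γ` as `s(a, b)` with `a < b`. A hollow diagonal crossing it has one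
endpoint on each side; record the first as a vertex and the second as a number of counterclockwise
steps from `a`. Non-crossing diagonals then form a chain in the product order, and for an accordion
diagonal this chain is a staircase from the boundary edge around `a` to the one around `b`
(`isStaircase_pairs`). `Z` and `S` are the two kinds of corners of the staircase, so that `ε(δ, γ)`
is [something to the right] minus [something to the left] (`slalomSign_pairEdge`).

Rotating `δ ∈ D` onto the preceding or the following solid vertices gives accordion diagonals with
`g`-vectors `e_δ` and `-e_δ`. As elements of `Sym2 (Fin n)` they are `counterclockwise δ` and `δ`
itself. Both cut out facets. Consider the point whose `δ`-coordinate is the height of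
`counterclockwise δ`. It satisfies every inequality: heights are sums of crossing numbers with
accordion diagonals `h`, and for each single `h` the claim is a summation by parts along the
staircase (`IsStaircase.sum_turn_le`), fed by the fact that a chord crosses two opposite sides of a
quadrilateral at most as often as its diagonals (`crossNumber_quadrilateral`). If `γ` has an `S` at
`f`, the choice `h = counterclockwise f` gains 1, so the point may also be lowered by 1 along any
coordinate. These translates span the facet of `counterclockwise δ`. The point with coordinates
minus the height of `δ` serves the other rotation in the same way.

Conversely, a facet is some `F(γ)`, with direction orthogonal to `g(γ)`. Parallel facets have
proportional `g`-vectors, hence equal or opposite ones, the entries being `0` and `±1`. Equal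
vectors give the same facet. Opposite vectors come only from the two rotations of one `δ`: otherwise
`γ` has a `Z` and an `S` at two diagonals with a common endpoint, and the cyclic order of their
endpoints determines which is which, so no `γ'` can have the opposite signs
(`eq_counterclockwise_of_opposite`). -/

section Staircase

/-! ### Staircases in a product of two linear orders -/

variable {X α β : Type*} [LinearOrder α] [LinearOrder β]

-- The two indicators cancel except at the minimum and the maximum of `k`, so the sum is the value
-- of `f` at the minimum minus its value at the maximum.
open Classical in
theorem sum_extremes_nonpos (T : Finset X) (k : X → α) (hk : Set.InjOn k T) (f : X → ℝ)
    (hf : ∀ x ∈ T, ∀ y ∈ T, k x < k y → f x ≤ f y) :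
    ∑ x ∈ T, ((if ∃ y ∈ T, k x < k y then (1 : ℝ) else 0) -
      (if ∃ y ∈ T, k y < k x then 1 else 0)) * f x ≤ 0 := by
  rcases T.eq_empty_or_nonempty with rfl | hT
  · simp
  obtain ⟨p, hp, hp'⟩ := T.exists_min_image k hT
  obtain ⟨q, hq, hq'⟩ := T.exists_max_image k hT
  have h : ∀ x ∈ T, ((if ∃ y ∈ T, k x < k y then (1 : ℝ) else 0) -
      (if ∃ y ∈ T, k y < k x then 1 else 0)) * f x =
      (if x = p then f x else 0) - (if x = q then f x else 0) := by
    intro x hx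
    have h1 : (∃ y ∈ T, k x < k y) ↔ x ≠ q :=
      ⟨fun ⟨y, hy, hxy⟩ hxq => absurd (hq' y hy) (not_le.2 (hxq ▸ hxy)),
        fun hxq => ⟨q, hq, lt_of_le_of_ne (hq' x hx) fun h => hxq (hk hx hq h)⟩⟩
    have h2 : (∃ y ∈ T, k y < k x) ↔ x ≠ p :=
      ⟨fun ⟨y, hy, hxy⟩ hxp => absurd (hp' y hy) (not_le.2 (hxp ▸ hxy)),
        fun hxp => ⟨p, hp, lt_of_le_of_ne (hp' x hx) fun h => hxp (hk hp hx h).symm⟩⟩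
    simp only [h1, h2]
    by_cases hxq : x = q <;> by_cases hxp : x = p <;> simp [hxq, hxp] <;> split_ifs <;> simp
  rw [Finset.sum_congr rfl h, Finset.sum_sub_distrib, Finset.sum_ite_eq' T p,
    Finset.sum_ite_eq' T q, if_pos hp, if_pos hq, sub_nonpos]
  rcases (hp' q hq).eq_or_lt with h | h
  · rw [hk hp hq h]
  · exact hf p hp q hq h

/-- Some point of `S` in the row of `x` lies to its left. -/
def HasLeft (S : Finset (α × β)) (x : α × β) : Prop := ∃ i, i < x.1 ∧ (i, x.2) ∈ S

/-- Some point of `S` in the row of `x` lies to its right. -/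
def HasRight (S : Finset (α × β)) (x : α × β) : Prop := ∃ i, x.1 < i ∧ (i, x.2) ∈ S

/-- Some point of `S` in the column of `x` lies below it. -/
def HasBelow (S : Finset (α × β)) (x : α × β) : Prop := ∃ r, r < x.2 ∧ (x.1, r) ∈ S

/-- Some point of `S` in the column of `x` lies above it. -/
def HasAbove (S : Finset (α × β)) (x : α × β) : Prop := ∃ r, x.2 < r ∧ (x.1, r) ∈ S

/-- `S` is a finite chain from `p` to `q` in the product order, in which two successive points
have a common coordinate. -/
structure IsStaircase (S : Finset (α × β)) (p q : α × β) : Prop where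
  chain : ∀ x ∈ S, ∀ y ∈ S, x.1 < y.1 → x.2 ≤ y.2
  first_mem : p ∈ S
  last_mem : q ∈ S
  first_le : ∀ x ∈ S, p.1 ≤ x.1 ∧ p.2 ≤ x.2
  le_last : ∀ x ∈ S, x.1 ≤ q.1 ∧ x.2 ≤ q.2
  prev : ∀ x ∈ S, x ≠ p → HasLeft S x ∨ HasBelow S x
  next : ∀ x ∈ S, x ≠ q → HasRight S x ∨ HasAbove S x

namespace IsStaircase

variable {S : Finset (α × β)} {p q : α × β}

/-- The point to the left and the point below would be incomparable. -/
theorem not_left_and_below (h : IsStaircase S p q) {x : α × β} (hl : HasLeft S x)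
    (hb : HasBelow S x) : False := by
  obtain ⟨i, hi, hi'⟩ := hl
  obtain ⟨r, hr, hr'⟩ := hb
  exact absurd (h.chain _ hi' _ hr' hi) (not_le.2 hr)

theorem not_right_and_above (h : IsStaircase S p q) {x : α × β} (hl : HasRight S x)
    (hb : HasAbove S x) : False := by
  obtain ⟨i, hi, hi'⟩ := hl
  obtain ⟨r, hr, hr'⟩ := hb
  exact absurd (h.chain _ hr' _ hi' hi) (not_le.2 hr)

-- Summation by parts. In each row the coefficients applied to `φ + ψ` leave the first value minus
-- the last, which `hφ` makes nonpositive; in each column `ψ` is constant; the horizontal and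
-- vertical coefficients of `ψ` together leave only the two ends of the staircase.
open Classical in
theorem sum_turn_le (h : IsStaircase S p q) (φ : α × β → ℝ) (ψ : α → ℝ)
    (hφ : ∀ i j r, (i, r) ∈ S → (j, r) ∈ S → i < j → φ (i, r) - φ (j, r) ≤ ψ j - ψ i) :
    ∑ x ∈ S, ((if HasRight S x then (1 : ℝ) else 0) - (if HasLeft S x then 1 else 0)) * φ x ≤
      ψ q.1 - ψ p.1 := by
  have rows : ∑ x ∈ S, ((if HasRight S x then (1 : ℝ) else 0) -
      (if HasLeft S x then 1 else 0)) * (φ x + ψ x.1) ≤ 0 := by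
    rw [← Finset.sum_fiberwise_of_maps_to (fun x hx => Finset.mem_image_of_mem Prod.snd hx)]
    refine Finset.sum_nonpos fun r _ => ?_
    refine le_of_eq_of_le (Finset.sum_congr rfl fun x hx => ?_)
      (sum_extremes_nonpos (S.filter fun x => x.2 = r) Prod.fst ?_
        (fun x => φ x + ψ x.1) ?_)
    · obtain ⟨hx, rfl⟩ := Finset.mem_filter.1 hx
      have h1 : HasRight S x ↔ ∃ y ∈ S.filter (fun y => y.2 = x.2), x.1 < y.1 :=
        ⟨fun ⟨i, hi, hi'⟩ => ⟨(i, x.2), by simp [hi'], hi⟩,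
          fun ⟨y, hy, hxy⟩ => ⟨y.1, hxy, by
            obtain ⟨hy, hy'⟩ := Finset.mem_filter.1 hy
            rwa [← hy']⟩⟩
      have h2 : HasLeft S x ↔ ∃ y ∈ S.filter (fun y => y.2 = x.2), y.1 < x.1 :=
        ⟨fun ⟨i, hi, hi'⟩ => ⟨(i, x.2), by simp [hi'], hi⟩,
          fun ⟨y, hy, hxy⟩ => ⟨y.1, hxy, by
            obtain ⟨hy, hy'⟩ := Finset.mem_filter.1 hy
            rwa [← hy']⟩⟩
      simp only [h1, h2]
    · intro x hx y hy hxy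
      have hx := (Finset.mem_filter.1 hx).2
      have hy := (Finset.mem_filter.1 hy).2
      exact Prod.ext hxy (hx.trans hy.symm)
    · rintro ⟨i, s⟩ hx ⟨j, t⟩ hy hxy
      obtain ⟨hx, hr⟩ := Finset.mem_filter.1 hx
      obtain ⟨hy, hs⟩ := Finset.mem_filter.1 hy
      obtain rfl : s = t := hr.trans hs.symm
      have := hφ i j s hx hy hxy
      simp only
      linarith
  have columns : ∑ x ∈ S, ((if HasAbove S x then (1 : ℝ) else 0) -
      (if HasBelow S x then 1 else 0)) * ψ x.1 ≤ 0 := by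
    rw [← Finset.sum_fiberwise_of_maps_to (fun x hx => Finset.mem_image_of_mem Prod.fst hx)]
    refine Finset.sum_nonpos fun i _ => ?_
    refine le_of_eq_of_le (Finset.sum_congr rfl fun x hx => ?_)
      (sum_extremes_nonpos (S.filter fun x => x.1 = i) Prod.snd ?_ (fun x => ψ x.1) ?_)
    · obtain ⟨hx, rfl⟩ := Finset.mem_filter.1 hx
      have h1 : HasAbove S x ↔ ∃ y ∈ S.filter (fun y => y.1 = x.1), x.2 < y.2 :=
        ⟨fun ⟨i, hi, hi'⟩ => ⟨(x.1, i), by simp [hi'], hi⟩,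
          fun ⟨y, hy, hxy⟩ => ⟨y.2, hxy, by
            obtain ⟨hy, hy'⟩ := Finset.mem_filter.1 hy
            rwa [← hy']⟩⟩
      have h2 : HasBelow S x ↔ ∃ y ∈ S.filter (fun y => y.1 = x.1), y.2 < x.2 :=
        ⟨fun ⟨i, hi, hi'⟩ => ⟨(x.1, i), by simp [hi'], hi⟩,
          fun ⟨y, hy, hxy⟩ => ⟨y.2, hxy, by
            obtain ⟨hy, hy'⟩ := Finset.mem_filter.1 hy
            rwa [← hy']⟩⟩
      simp only [h1, h2]
    · intro x hx y hy hxy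
      have hx := (Finset.mem_filter.1 hx).2
      have hy := (Finset.mem_filter.1 hy).2
      exact Prod.ext (hx.trans hy.symm) hxy
    · intro x hx y hy _
      rw [(Finset.mem_filter.1 hx).2, (Finset.mem_filter.1 hy).2]
  have total : ∑ x ∈ S, (((if HasRight S x then (1 : ℝ) else 0) -
      (if HasLeft S x then 1 else 0)) + ((if HasAbove S x then (1 : ℝ) else 0) -
      (if HasBelow S x then 1 else 0))) * ψ x.1 = ψ p.1 - ψ q.1 := by
    -- A point other than `p` is entered from exactly one of left and below, and a point other than
    -- `q` is left in exactly one of the two directions.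
    have hx : ∀ x ∈ S, (((if HasRight S x then (1 : ℝ) else 0) -
      (if HasLeft S x then 1 else 0)) + ((if HasAbove S x then (1 : ℝ) else 0) -
      (if HasBelow S x then 1 else 0))) * ψ x.1 =
        (if x = p then ψ x.1 else 0) - (if x = q then ψ x.1 else 0) := by
      intro x hx
      have h1 : (if HasLeft S x then (1 : ℝ) else 0) + (if HasBelow S x then 1 else 0) =
          if x = p then 0 else 1 := by
        by_cases hp : x = p
        · have hl : ¬ HasLeft S x := fun ⟨i, hi, hi'⟩ =>
            absurd (h.first_le _ hi').1 (not_le.2 (hp ▸ hi))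
          have hb : ¬ HasBelow S x := fun ⟨i, hi, hi'⟩ =>
            absurd (h.first_le _ hi').2 (not_le.2 (hp ▸ hi))
          rw [if_neg hl, if_neg hb, if_pos hp, add_zero]
        · rcases h.prev x hx hp with hl | hb
          · have hb : ¬ HasBelow S x := fun hb => h.not_left_and_below hl hb
            simp [hl, hb, hp]
          · have hl : ¬ HasLeft S x := fun hl => h.not_left_and_below hl hb
            simp [hl, hb, hp]
      have h2 : (if HasRight S x then (1 : ℝ) else 0) + (if HasAbove S x then 1 else 0) =
          if x = q then 0 else 1 := by
        by_cases hp : x = q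
        · have hl : ¬ HasRight S x := fun ⟨i, hi, hi'⟩ =>
            absurd (h.le_last _ hi').1 (not_le.2 (hp ▸ hi))
          have hb : ¬ HasAbove S x := fun ⟨i, hi, hi'⟩ =>
            absurd (h.le_last _ hi').2 (not_le.2 (hp ▸ hi))
          rw [if_neg hl, if_neg hb, if_pos hp, add_zero]
        · rcases h.next x hx hp with hl | hb
          · have hb : ¬ HasAbove S x := fun hb => h.not_right_and_above hl hb
            simp [hl, hb, hp]
          · have hl : ¬ HasRight S x := fun hl => h.not_right_and_above hl hb
            simp [hl, hb, hp]
      have h3 : (if x = p then ψ x.1 else 0) = (1 - if x = p then 0 else 1) * ψ x.1 := by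
        split_ifs <;> simp
      have h4 : (if x = q then ψ x.1 else 0) = (1 - if x = q then 0 else 1) * ψ x.1 := by
        split_ifs <;> simp
      rw [h3, h4, ← h1, ← h2]
      ring
    rw [Finset.sum_congr rfl hx, Finset.sum_sub_distrib, Finset.sum_ite_eq' S p,
      Finset.sum_ite_eq' S q, if_pos h.first_mem, if_pos h.last_mem]
  simp only [mul_add, add_mul, Finset.sum_add_distrib] at rows total
  linarith

/-- A `Z` turn which is not in the first column shares that column with an `S` turn. -/
theorem exists_turn_below (h : IsStaircase S p q) {x : α × β} (hx : x ∈ S)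
    (hb : HasBelow S x) (hp : x.1 ≠ p.1) :
    ∃ r, (x.1, r) ∈ S ∧ HasLeft S (x.1, r) ∧ HasAbove S (x.1, r) := by
  obtain ⟨r, hr, hr'⟩ := hb
  obtain ⟨y, hy, hmin⟩ := (S.filter fun y => y.1 = x.1).exists_min_image Prod.snd
    ⟨(x.1, r), by simp [hr']⟩
  obtain ⟨hy, hy'⟩ := Finset.mem_filter.1 hy
  have e : y = (x.1, y.2) := Prod.ext hy' rfl
  have hyr : y.2 ≤ r := hmin (x.1, r) (by simp [hr'])
  refine ⟨y.2, e ▸ hy, ?_, x.2, lt_of_le_of_lt hyr hr, hx⟩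
  rw [← e]
  refine (h.prev y hy fun hyp => hp (hy' ▸ hyp ▸ rfl)).resolve_right ?_
  rintro ⟨s, hs, hs'⟩
  exact absurd (hmin (y.1, s) (Finset.mem_filter.2 ⟨hs', hy'⟩)) (not_le.2 hs)

/-- The last point of the row is not `q`, so the staircase can leave it only upwards. The next two
lemmas exchange the roles of the two kinds of turns. -/
theorem exists_turn_right (h : IsStaircase S p q) {x : α × β} (hx : x ∈ S)
    (hb : HasRight S x) (hq : x.2 ≠ q.2) :
    ∃ i, (i, x.2) ∈ S ∧ HasLeft S (i, x.2) ∧ HasAbove S (i, x.2) := by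
  obtain ⟨r, hr, hr'⟩ := hb
  obtain ⟨y, hy, hmax⟩ := (S.filter fun y => y.2 = x.2).exists_max_image Prod.fst
    ⟨(r, x.2), by simp [hr']⟩
  obtain ⟨hy, hy'⟩ := Finset.mem_filter.1 hy
  have e : y = (y.1, x.2) := Prod.ext rfl hy'
  have hyr : r ≤ y.1 := hmax (r, x.2) (by simp [hr'])
  refine ⟨y.1, e ▸ hy, ⟨x.1, lt_of_lt_of_le hr hyr, hx⟩, ?_⟩
  rw [← e]
  refine (h.next y hy fun hyp => hq (hy' ▸ hyp ▸ rfl)).resolve_left ?_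
  rintro ⟨s, hs, hs'⟩
  exact absurd (hmax (s, y.2) (Finset.mem_filter.2 ⟨hs', hy'⟩)) (not_le.2 hs)

theorem exists_turn_above (h : IsStaircase S p q) {x : α × β} (hx : x ∈ S)
    (hb : HasAbove S x) (hq : x.1 ≠ q.1) :
    ∃ r, (x.1, r) ∈ S ∧ HasRight S (x.1, r) ∧ HasBelow S (x.1, r) := by
  obtain ⟨r, hr, hr'⟩ := hb
  obtain ⟨y, hy, hmax⟩ := (S.filter fun y => y.1 = x.1).exists_max_image Prod.snd
    ⟨(x.1, r), by simp [hr']⟩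
  obtain ⟨hy, hy'⟩ := Finset.mem_filter.1 hy
  have e : y = (x.1, y.2) := Prod.ext hy' rfl
  have hyr : r ≤ y.2 := hmax (x.1, r) (by simp [hr'])
  refine ⟨y.2, e ▸ hy, ?_, x.2, lt_of_lt_of_le hr hyr, hx⟩
  rw [← e]
  refine (h.next y hy fun hyp => hq (hy' ▸ hyp ▸ rfl)).resolve_right ?_
  rintro ⟨s, hs, hs'⟩
  exact absurd (hmax (y.1, s) (Finset.mem_filter.2 ⟨hs', hy'⟩)) (not_le.2 hs)

theorem exists_turn_left (h : IsStaircase S p q) {x : α × β} (hx : x ∈ S)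
    (hb : HasLeft S x) (hp : x.2 ≠ p.2) :
    ∃ i, (i, x.2) ∈ S ∧ HasRight S (i, x.2) ∧ HasBelow S (i, x.2) := by
  obtain ⟨r, hr, hr'⟩ := hb
  obtain ⟨y, hy, hmin⟩ := (S.filter fun y => y.2 = x.2).exists_min_image Prod.fst
    ⟨(r, x.2), by simp [hr']⟩
  obtain ⟨hy, hy'⟩ := Finset.mem_filter.1 hy
  have e : y = (y.1, x.2) := Prod.ext rfl hy'
  have hyr : y.1 ≤ r := hmin (r, x.2) (by simp [hr'])
  refine ⟨y.1, e ▸ hy, ⟨x.1, lt_of_le_of_lt hyr hr, hx⟩, ?_⟩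
  rw [← e]
  refine (h.prev y hy fun hyp => hp (hy' ▸ hyp ▸ rfl)).resolve_left ?_
  rintro ⟨s, hs, hs'⟩
  exact absurd (hmin (s, y.2) (Finset.mem_filter.2 ⟨hs', hy'⟩)) (not_le.2 hs)

end IsStaircase

end Staircase

/-! ### Crossing chords in terms of indices -/

theorem chordsCross_mk (a b c d : ℕ) :
    ChordsCross s(a, b) s(c, d) ↔ Clockwise a c b d ∨ Clockwise a d b c := by
  constructor
  · rintro ⟨a', b', c', d', h1, h2, h⟩
    rw [Sym2.eq_iff] at h1 h2
    rcases h1 with ⟨rfl, rfl⟩ | ⟨rfl, rfl⟩ <;> rcases h2 with ⟨rfl, rfl⟩ | ⟨rfl, rfl⟩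
    · exact .inl h
    · exact .inr h
    · refine .inr ?_
      rcases h with h | h | h | h <;> simp only [Clockwise, h, and_self, true_or, or_true]
    · refine .inl ?_
      rcases h with h | h | h | h <;> simp only [Clockwise, h, and_self, true_or, or_true]
  · rintro (h | h)
    · exact ⟨a, b, c, d, rfl, rfl, h⟩
    · exact ⟨a, b, d, c, rfl, Sym2.eq_swap, h⟩

/-- The chords `p q` and `x y` cross. -/
def Alternate (p q x y : ℕ) : Prop := Clockwise p x q y ∨ Clockwise p y q x

theorem alternate_iff {p q : ℕ} (hpq : p < q) (x y : ℕ) :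
    Alternate p q x y ↔
      (p < x ∧ x < q ∧ (y < p ∨ q < y)) ∨ (p < y ∧ y < q ∧ (x < p ∨ q < x)) := by
  constructor
  · rintro ((h | h | h | h) | (h | h | h | h)) <;> omega
  · unfold Alternate Clockwise
    rintro (⟨h1, h2, h | h⟩ | ⟨h1, h2, h | h⟩) <;> omega

/-- One end of the chord lies inside the arc from `x` to `y`. The other lies on the arc from `y`
back to `x`, and either its position up to and including `z` cuts `y` off from `w`, or its position
beyond `z` cuts `x` off from `z`. -/
theorem Alternate.uncross {p q x y z w : ℕ} (hpq : p < q) (h : Clockwise x y z w)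
    (hxy : Alternate p q x y) : Alternate p q x z ∨ Alternate p q y w := by
  rw [alternate_iff hpq] at *
  rw [alternate_iff hpq]
  rcases h with h | h | h | h <;> rcases hxy with ⟨h1, h2, h3⟩ | ⟨h1, h2, h3⟩ <;> omega

theorem Alternate.uncross' {p q x y z w : ℕ} (hpq : p < q) (h : Clockwise x y z w)
    (hxy : Alternate p q x y)
    (hzw : Alternate p q z w) : Alternate p q x z ∧ Alternate p q y w := by
  rw [alternate_iff hpq] at *
  rw [alternate_iff hpq]
  rcases h with h | h | h | h <;> rcases hxy with ⟨h1, h2, h3⟩ | ⟨h1, h2, h3⟩ <;> omega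

theorem clockwise_comp {f : ℕ → ℕ} (hf : StrictMono f) (a b c d : ℕ) :
    Clockwise (f a) (f b) (f c) (f d) ↔ Clockwise a b c d := by
  simp only [Clockwise, hf.lt_iff_lt]

section Crossings

variable {n : ℕ}

theorem hollowCross_mk (u v p q : Fin n) :
    HollowCross s(u, v) s(p, q) ↔ Alternate u v p q := by
  have hf : StrictMono fun k : ℕ => 2 * k + 1 := fun a b h => by simpa using h
  rw [HollowCross, Sym2.map_mk, Sym2.map_mk, chordsCross_mk]
  exact or_congr (clockwise_comp hf _ _ _ _) (clockwise_comp hf _ _ _ _)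

theorem solidCross_mk (u v p q : Fin n) :
    SolidCross s(u, v) s(p, q) ↔ Alternate u v p q := by
  have hf : StrictMono fun k : ℕ => 2 * k + 2 := fun a b h => by simpa using h
  rw [SolidCross, Sym2.map_mk, Sym2.map_mk, chordsCross_mk]
  exact or_congr (clockwise_comp hf _ _ _ _) (clockwise_comp hf _ _ _ _)

/-- On the circle the hollow vertex of an index comes just before the solid one; hence strict
inequality at `a` and weak inequality at `b`. -/
theorem hollowSolidCross_mk {a b : Fin n} (hab : a < b) (u v : Fin n) :
    HollowSolidCross s(u, v) s(a, b) ↔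
      (a < u ∧ u ≤ b ∧ (v ≤ a ∨ b < v)) ∨ (a < v ∧ v ≤ b ∧ (u ≤ a ∨ b < u)) := by
  rw [HollowSolidCross, Sym2.map_mk, Sym2.map_mk, chordsCross_mk]
  simp only [hollowLabel, solidLabel, Fin.lt_def, Fin.le_def] at *
  constructor
  · rintro ((h | h | h | h) | (h | h | h | h)) <;> omega
  · unfold Clockwise
    rintro (⟨h1, h2, h | h⟩ | ⟨h1, h2, h | h⟩) <;> omega

theorem Alternate.comm {a b c d : ℕ} (h : Alternate a b c d) : Alternate c d a b := by
  rcases h with (h | h | h | h) | (h | h | h | h) <;>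
    simp only [Alternate, Clockwise, h, and_self, true_or, or_true]

theorem Alternate.swap_left {a b c d : ℕ} (h : Alternate a b c d) : Alternate b a c d := by
  rcases h with (h | h | h | h) | (h | h | h | h) <;>
    simp only [Alternate, Clockwise, h, and_self, true_or, or_true]

theorem Alternate.swap_right {a b c d : ℕ} (h : Alternate a b c d) : Alternate a b d c :=
  h.symm

theorem HollowCross.symm {e f : Sym2 (Fin n)} (h : HollowCross e f) : HollowCross f e := by
  induction e with | _ u v
  induction f with | _ p q
  rw [hollowCross_mk] at *
  exact h.comm

theorem SolidCross.symm {e f : Sym2 (Fin n)} (h : SolidCross e f) : SolidCross f e := by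
  induction e with | _ u v
  induction f with | _ p q
  rw [solidCross_mk] at *
  exact h.comm

theorem val_finRotate (i : Fin n) :
    ((finRotate n i : Fin n) : ℕ) = if (i : ℕ) + 1 = n then 0 else (i : ℕ) + 1 := by
  cases n with
  | zero => exact i.elim0
  | succ n =>
    rw [coe_finRotate]
    simp [Fin.ext_iff]

theorem not_hollowCross_boundary {e f : Sym2 (Fin n)} (he : IsBoundaryEdge e) :
    ¬ HollowCross e f := by
  obtain ⟨i, rfl⟩ := he
  induction f with | _ p q
  rw [hollowCross_mk, val_finRotate]
  have := i.2
  have := p.2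
  have := q.2
  split_ifs with h <;> rintro ((h | h | h | h) | (h | h | h | h)) <;> omega

theorem HollowDissection.not_hollowCross (D : HollowDissection n) {e f : Sym2 (Fin n)}
    (he : e ∈ D.withBoundary) (hf : f ∈ D.withBoundary) : ¬ HollowCross e f := by
  rcases he with he | he
  · rcases hf with hf | hf
    · exact D.noncrossing e he f hf
    · exact fun h => not_hollowCross_boundary hf h.symm
  · exact not_hollowCross_boundary he

end Crossings

/-! ### Coordinates of the hollow diagonals crossed by a solid diagonal -/

section Pairs

variable {n : ℕ}

/-- The hollow vertex met after `r` counterclockwise steps from the vertex `a`. -/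
def stepBack (a r : Fin n) : Fin n :=
  ⟨if r ≤ a then a - r else a + n - r, by split_ifs <;> omega⟩

theorem val_stepBack (a r : Fin n) :
    (stepBack a r : ℕ) = if (r : ℕ) ≤ a then (a : ℕ) - r else a + n - r := rfl

/-- This is subtraction from `a` modulo `n`, an involution: the same function turns step counts into
vertices and vertices into step counts. -/
theorem stepBack_stepBack (a r : Fin n) : stepBack a (stepBack a r) = r := by
  ext
  simp only [val_stepBack]
  split_ifs <;> omega

theorem stepBack_injective (a : Fin n) : Function.Injective (stepBack a) :=
  (Function.LeftInverse.injective (stepBack_stepBack a))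

/-- The pair `x` is admissible for the solid diagonal `a b`: its first coordinate is a hollow
vertex between `a` and `b`, the second one is the number of steps from `a` to a hollow vertex on
the other side. -/
def Admissible (a b : Fin n) (x : Fin n × Fin n) : Prop :=
  a < x.1 ∧ x.1 ≤ b ∧ (x.2 : ℕ) + b < a + n

/-- The hollow diagonal encoded by a pair of coordinates. -/
def pairEdge (a : Fin n) (x : Fin n × Fin n) : Sym2 (Fin n) := s(x.1, stepBack a x.2)

theorem stepBack_outside {a b r : Fin n} :
    (stepBack a r ≤ a ∨ b < stepBack a r) ↔ (r : ℕ) + b < a + n := by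
  rw [Fin.le_def, Fin.lt_def, val_stepBack]
  split_ifs <;> omega

theorem hollowSolidCross_iff {a b : Fin n} (hab : a < b) (e : Sym2 (Fin n)) :
    HollowSolidCross e s(a, b) ↔ ∃ x, Admissible a b x ∧ pairEdge a x = e := by
  induction e with | _ u v
  rw [hollowSolidCross_mk hab]
  constructor
  · rintro (⟨h1, h2, h⟩ | ⟨h1, h2, h⟩)
    · exact ⟨(u, stepBack a v), ⟨h1, h2, stepBack_outside.1 (by rwa [stepBack_stepBack])⟩,
        by simp [pairEdge, stepBack_stepBack]⟩
    · exact ⟨(v, stepBack a u), ⟨h1, h2, stepBack_outside.1 (by rwa [stepBack_stepBack])⟩,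
        by simp [pairEdge, stepBack_stepBack, Sym2.eq_swap]⟩
  · rintro ⟨x, ⟨h1, h2, h⟩, hx⟩
    rw [pairEdge, Sym2.eq_iff] at hx
    rw [← stepBack_outside] at h
    rcases hx with ⟨rfl, rfl⟩ | ⟨rfl, rfl⟩
    · exact .inl ⟨h1, h2, h⟩
    · exact .inr ⟨h1, h2, h⟩

theorem stepBack_ne {a b : Fin n} {x y : Fin n × Fin n} (hx : Admissible a b x)
    (hy : Admissible a b y) : stepBack a x.2 ≠ y.1 := by
  have := stepBack_outside.2 hx.2.2
  rintro h
  rw [h] at this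
  exact this.elim (fun h => absurd hy.1 (not_lt.2 h)) fun h => absurd hy.2.1 (not_le.2 h)

theorem pairEdge_inj {a b : Fin n} {x y : Fin n × Fin n} (hx : Admissible a b x)
    (hy : Admissible a b y) (h : pairEdge a x = pairEdge a y) : x = y := by
  rw [pairEdge, pairEdge, Sym2.eq_iff] at h
  rcases h with ⟨h1, h2⟩ | ⟨h1, h2⟩
  · exact Prod.ext h1 (stepBack_injective a h2)
  · exact absurd h2 (stepBack_ne hx hy)

/-- The first coordinate runs clockwise on one side of the solid diagonal and the second
counterclockwise on the other, so both measure progress from `a` to `b`. Two chords progressing in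
opposite senses on the two sides must cross. -/
theorem alternate_edges {a b : Fin n} {x y : Fin n × Fin n}
    (hx : Admissible a b x) (hy : Admissible a b y) (h1 : x.1 < y.1) (h2 : y.2 < x.2) :
    HollowCross (pairEdge a x) (pairEdge a y) := by
  rw [pairEdge, pairEdge, hollowCross_mk]
  obtain ⟨hx1, hx2, hx3⟩ := hx
  obtain ⟨hy1, hy2, hy3⟩ := hy
  rw [Fin.lt_def] at *
  rw [Fin.le_def] at *
  unfold Alternate Clockwise
  simp only [val_stepBack]
  split_ifs <;> omega

open Classical in
/-- The coordinates of the hollow diagonals crossed by the solid diagonal `a b`. -/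
noncomputable def HollowDissection.pairs (D : HollowDissection n) (a b : Fin n) :
    Finset (Fin n × Fin n) :=
  Finset.univ.filter fun x => Admissible a b x ∧ pairEdge a x ∈ D.withBoundary

namespace HollowDissection

variable (D : HollowDissection n)

theorem mem_pairs {a b : Fin n} {x : Fin n × Fin n} :
    x ∈ D.pairs a b ↔ Admissible a b x ∧ pairEdge a x ∈ D.withBoundary := by
  simp [pairs]

theorem mem_crossed_iff {a b : Fin n} (hab : a < b) (e : Sym2 (Fin n)) :
    e ∈ D.crossed s(a, b) ↔ ∃ x ∈ D.pairs a b, pairEdge a x = e := by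
  rw [crossed, Set.mem_ofPred_eq, hollowSolidCross_iff hab]
  constructor
  · rintro ⟨he, x, hx, rfl⟩
    exact ⟨x, D.mem_pairs.2 ⟨hx, he⟩, rfl⟩
  · rintro ⟨x, hx, rfl⟩
    exact ⟨(D.mem_pairs.1 hx).2, x, (D.mem_pairs.1 hx).1, rfl⟩

theorem pairs_chain {a b : Fin n} {x y : Fin n × Fin n} (hx : x ∈ D.pairs a b)
    (hy : y ∈ D.pairs a b) (h : x.1 < y.1) : x.2 ≤ y.2 := by
  rw [mem_pairs] at hx hy
  by_contra! h'
  exact D.not_hollowCross hx.2 hy.2 (alternate_edges hx.1 hy.1 h h')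

/-- The pair of the boundary edge around the solid vertex `a`. -/
def firstPair {a b : Fin n} (hab : a < b) : Fin n × Fin n :=
  (⟨a + 1, by omega⟩, ⟨0, by omega⟩)

/-- The pair of the boundary edge around the solid vertex `b`. -/
def lastPair {a b : Fin n} (hab : a < b) : Fin n × Fin n :=
  (b, ⟨a + n - b - 1, by omega⟩)

theorem isBoundaryEdge_firstPair {a b : Fin n} (hab : a < b) :
    IsBoundaryEdge (pairEdge a (firstPair hab)) := by
  refine ⟨a, ?_⟩
  rw [pairEdge, Sym2.eq_iff]
  refine .inr ⟨?_, ?_⟩ <;> ext <;> simp only [firstPair, val_finRotate, val_stepBack]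
  · rw [if_neg (by omega)]
  · rw [if_pos (by omega)]; rfl

theorem isBoundaryEdge_lastPair {a b : Fin n} (hab : a < b) :
    IsBoundaryEdge (pairEdge a (lastPair hab)) := by
  refine ⟨b, ?_⟩
  rw [pairEdge, Sym2.eq_iff]
  refine .inl ⟨rfl, ?_⟩
  ext
  simp only [lastPair, val_finRotate, val_stepBack]
  split_ifs <;> omega

theorem firstPair_mem {a b : Fin n} (hab : a < b) : firstPair hab ∈ D.pairs a b := by
  rw [mem_pairs]
  refine ⟨⟨?_, ?_, ?_⟩, .inr (isBoundaryEdge_firstPair hab)⟩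
  · simp [firstPair, Fin.lt_def]
  · simp only [firstPair, Fin.le_def]; omega
  · simp only [firstPair]; omega

theorem lastPair_mem {a b : Fin n} (hab : a < b) : lastPair hab ∈ D.pairs a b := by
  rw [mem_pairs]
  refine ⟨⟨hab, le_rfl, ?_⟩, .inr (isBoundaryEdge_lastPair hab)⟩
  simp only [lastPair]; omega

theorem firstPair_le {a b : Fin n} (hab : a < b) {x : Fin n × Fin n} (hx : x ∈ D.pairs a b) :
    (firstPair hab).1 ≤ x.1 ∧ (firstPair hab).2 ≤ x.2 := by
  obtain ⟨⟨h1, h2, h3⟩, -⟩ := D.mem_pairs.1 hx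
  simp only [firstPair, Fin.le_def, Fin.lt_def] at *
  omega

theorem le_lastPair {a b : Fin n} (hab : a < b) {x : Fin n × Fin n} (hx : x ∈ D.pairs a b) :
    x.1 ≤ (lastPair hab).1 ∧ x.2 ≤ (lastPair hab).2 := by
  obtain ⟨⟨h1, h2, h3⟩, -⟩ := D.mem_pairs.1 hx
  simp only [lastPair, Fin.le_def, Fin.lt_def] at *
  omega

theorem eq_of_boundary {a b : Fin n} (hab : a < b) {x : Fin n × Fin n} (hx : Admissible a b x)
    (h : IsBoundaryEdge (pairEdge a x)) : x = firstPair hab ∨ x = lastPair hab := by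
  obtain ⟨i, hi⟩ := h
  obtain ⟨h1, h2, h3⟩ := hx
  rw [pairEdge, Sym2.eq_iff] at hi
  simp only [Fin.ext_iff, Prod.ext_iff, val_finRotate, val_stepBack, firstPair, lastPair, Fin.lt_def,
    Fin.le_def] at *
  have := i.2
  have := x.2.2
  split_ifs at hi <;> omega

theorem pairEdge_mem_diagonals {a b : Fin n} (hab : a < b) {x : Fin n × Fin n}
    (hx : x ∈ D.pairs a b) (h1 : x ≠ firstPair hab) (h2 : x ≠ lastPair hab) :
    pairEdge a x ∈ D.diagonals := by
  obtain ⟨hx, h | h⟩ := D.mem_pairs.1 hx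
  · exact h
  · exact absurd (eq_of_boundary hab hx h) (not_or.2 ⟨h1, h2⟩)

theorem share_coordinate {a b : Fin n} {x y : Fin n × Fin n}
    (hx : Admissible a b x) (hy : Admissible a b y) {v : Fin n} (hvx : v ∈ pairEdge a x)
    (hvy : v ∈ pairEdge a y) : x.1 = y.1 ∨ x.2 = y.2 := by
  rw [pairEdge, Sym2.mem_iff] at hvx hvy
  rcases hvx with rfl | rfl <;> rcases hvy with h | h
  · exact .inl h
  · exact absurd h.symm (stepBack_ne hy hx)
  · exact absurd h (stepBack_ne hx hy)
  · exact .inr (stepBack_injective a h)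

/-- A set of diagonals crossed by an accordion diagonal that is closed under adjacency and
contains one of them contains all of them. -/
theorem IsAccordionDiagonal.closed {a b : Fin n} (hab : a < b)
    (hD : D.IsAccordionDiagonal s(a, b)) (P : Fin n × Fin n → Prop)
    (hP : ∀ x ∈ D.pairs a b, ∀ y ∈ D.pairs a b, P x → (x.1 = y.1 ∨ x.2 = y.2) → P y)
    {x y : Fin n × Fin n} (hx : x ∈ D.pairs a b) (hy : y ∈ D.pairs a b) (h : P x) : P y := by
  have key : ∀ f, Relation.ReflTransGen (fun e₁ e₂ => e₁ ∈ D.crossed s(a, b) ∧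
      e₂ ∈ D.crossed s(a, b) ∧ ∃ v, v ∈ e₁ ∧ v ∈ e₂) (pairEdge a x) f →
      ∀ z ∈ D.pairs a b, pairEdge a z = f → P z := by
    intro f hf
    induction hf with
    | refl =>
      intro z hz he
      rwa [pairEdge_inj (D.mem_pairs.1 hz).1 (D.mem_pairs.1 hx).1 he]
    | tail _ hst ih =>
      rintro z hz rfl
      obtain ⟨h1, -, v, hv, hv'⟩ := hst
      obtain ⟨w, hw, rfl⟩ := (D.mem_crossed_iff hab _).1 h1
      exact hP w hw z hz (ih w hw rfl)
        (share_coordinate (D.mem_pairs.1 hw).1 (D.mem_pairs.1 hz).1 hv hv')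
  exact key _ (hD.2 _ ((D.mem_crossed_iff hab _).2 ⟨x, hx, rfl⟩) _
    ((D.mem_crossed_iff hab _).2 ⟨y, hy, rfl⟩)) y hy rfl

/-- The chain and end conditions come from non-crossing and from the two boundary edges. If `x` had
no point to its left or below it, the points strictly left of `x.1` would be closed under sharing a
coordinate; they contain the first pair but not `x`, against connectedness. The condition `next` is
symmetric. -/
theorem isStaircase_pairs {a b : Fin n} (hab : a < b) (hD : D.IsAccordionDiagonal s(a, b)) :
    IsStaircase (D.pairs a b) (firstPair hab) (lastPair hab) where
  chain x hx y hy := D.pairs_chain hx hy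
  first_mem := D.firstPair_mem hab
  last_mem := D.lastPair_mem hab
  first_le x hx := D.firstPair_le hab hx
  le_last x hx := D.le_lastPair hab hx
  prev x hx hne := by
    by_contra! h
    obtain ⟨h1, h2⟩ := h
    have hl := D.firstPair_le hab hx
    -- In the same column the first pair would itself be a point below `x`.
    have hlt : (firstPair hab).1 < x.1 := by
      refine lt_of_le_of_ne hl.1 fun he => ?_
      refine h2 ⟨(firstPair hab).2, lt_of_le_of_ne hl.2 fun he' => hne ?_, ?_⟩
      · exact Prod.ext he.symm he'.symm
      · exact he ▸ D.firstPair_mem hab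
    refine absurd (IsAccordionDiagonal.closed D hab hD (fun y => y.1 < x.1) ?_
      (D.firstPair_mem hab) hx hlt) (lt_irrefl _)
    rintro y hy z hz hyx (hyz | hyz)
    · exact hyz ▸ hyx
    · by_contra! hz'
      have := D.pairs_chain hy hx hyx
      rcases this.eq_or_lt with he | he
      · exact h1 ⟨y.1, hyx, by rwa [← he]⟩
      · rcases hz'.eq_or_lt with he' | he'
        · exact h2 ⟨z.2, hyz ▸ he, by rwa [he']⟩
        · exact absurd (D.pairs_chain hx hz he') (not_le.2 (hyz ▸ he))
  next x hx hne := by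
    by_contra! h
    obtain ⟨h1, h2⟩ := h
    have hl := D.le_lastPair hab hx
    have hlt : x.1 < (lastPair hab).1 := by
      refine lt_of_le_of_ne hl.1 fun he => ?_
      refine h2 ⟨(lastPair hab).2, lt_of_le_of_ne hl.2 fun he' => hne ?_, ?_⟩
      · exact Prod.ext he he'
      · exact he ▸ D.lastPair_mem hab
    refine absurd (IsAccordionDiagonal.closed D hab hD (fun y => x.1 < y.1) ?_
      (D.lastPair_mem hab) hx hlt) (lt_irrefl _)
    rintro y hy z hz hyx (hyz | hyz)
    · exact hyz ▸ hyx
    · by_contra! hz'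
      have := D.pairs_chain hx hy hyx
      rcases this.eq_or_lt with he | he
      · exact h1 ⟨y.1, hyx, by rwa [he]⟩
      · rcases hz'.eq_or_lt with he' | he'
        · exact h2 ⟨z.2, hyz ▸ he, by rwa [← he']⟩
        · exact absurd (D.pairs_chain hz hx he') (not_le.2 (hyz ▸ he))

end HollowDissection

end Pairs

/-- The chord `s t` separates `p` from `q`, and `c` lies strictly on one side of it. -/
theorem Alternate.separates {s t p q : ℕ} (h : Alternate s t p q) {c : ℕ} (hs : c ≠ s)
    (ht : c ≠ t) : Alternate s t c p ∨ Alternate s t c q := by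
  rcases lt_trichotomy s t with hst | rfl | hst
  · rw [alternate_iff hst] at *
    rw [alternate_iff hst]
    omega
  · rcases h with (h | h | h | h) | (h | h | h | h) <;> omega
  · have h := h.swap_left
    refine Or.imp Alternate.swap_left Alternate.swap_left ?_
    rw [alternate_iff hst] at *
    rw [alternate_iff hst]
    omega

/-! ### Successive points of a staircase -/

section Staircase

variable {α β : Type*} [LinearOrder α] [LinearOrder β]

/-- The points `y < x` of `S` are successive in `S`. -/
def Successive (S : Finset (α × β)) (y x : α × β) : Prop :=
  y ∈ S ∧ x ∈ S ∧ y < x ∧ ∀ w ∈ S, y ≤ w → w ≤ x → w = y ∨ w = x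

/-- Anything between two points of one column in the product order stays in that column, so the
nearest point below is an immediate predecessor. The same holds in the other three directions. -/
theorem HasBelow.exists_successive {S : Finset (α × β)} {x : α × β} (hx : x ∈ S)
    (h : HasBelow S x) : ∃ y, Successive S y x ∧ y.1 = x.1 := by
  obtain ⟨r, hr, hr'⟩ := h
  obtain ⟨y, hy, hmax⟩ := (S.filter fun y => y.1 = x.1 ∧ y.2 < x.2).exists_max_image Prod.snd
    ⟨(x.1, r), by simp [hr, hr']⟩
  obtain ⟨hy, hy1, hy2⟩ := Finset.mem_filter.1 hy
  refine ⟨y, ⟨hy, hx, Prod.lt_iff.2 (.inr ⟨hy1.le, hy2⟩), fun w hw hyw hwx => ?_⟩, hy1⟩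
  have hw1 : w.1 = x.1 := le_antisymm hwx.1 (hy1 ▸ hyw.1)
  rcases hwx.2.eq_or_lt with h | h
  · exact .inr (Prod.ext hw1 h)
  · exact .inl (Prod.ext (hw1.trans hy1.symm)
      (le_antisymm (hmax w (Finset.mem_filter.2 ⟨hw, hw1, h⟩)) hyw.2))

theorem HasAbove.exists_successive {S : Finset (α × β)} {x : α × β} (hx : x ∈ S)
    (h : HasAbove S x) : ∃ y, Successive S x y ∧ x.1 = y.1 := by
  obtain ⟨r, hr, hr'⟩ := h
  obtain ⟨y, hy, hmin⟩ := (S.filter fun y => y.1 = x.1 ∧ x.2 < y.2).exists_min_image Prod.snd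
    ⟨(x.1, r), by simp [hr, hr']⟩
  obtain ⟨hy, hy1, hy2⟩ := Finset.mem_filter.1 hy
  refine ⟨y, ⟨hx, hy, Prod.lt_iff.2 (.inr ⟨hy1.ge, hy2⟩), fun w hw hyw hwx => ?_⟩, hy1.symm⟩
  have hw1 : w.1 = x.1 := le_antisymm (hy1 ▸ hwx.1) hyw.1
  rcases hyw.2.eq_or_lt with h | h
  · exact .inl (Prod.ext hw1 h.symm)
  · exact .inr (Prod.ext (hw1.trans hy1.symm)
      (le_antisymm hwx.2 (hmin w (Finset.mem_filter.2 ⟨hw, hw1, h⟩))))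

theorem HasLeft.exists_successive {S : Finset (α × β)} {x : α × β} (hx : x ∈ S)
    (h : HasLeft S x) : ∃ y, Successive S y x ∧ y.2 = x.2 := by
  obtain ⟨r, hr, hr'⟩ := h
  obtain ⟨y, hy, hmax⟩ := (S.filter fun y => y.2 = x.2 ∧ y.1 < x.1).exists_max_image Prod.fst
    ⟨(r, x.2), by simp [hr, hr']⟩
  obtain ⟨hy, hy1, hy2⟩ := Finset.mem_filter.1 hy
  refine ⟨y, ⟨hy, hx, Prod.lt_iff.2 (.inl ⟨hy2, hy1.le⟩), fun w hw hyw hwx => ?_⟩, hy1⟩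
  have hw1 : w.2 = x.2 := le_antisymm hwx.2 (hy1 ▸ hyw.2)
  rcases hwx.1.eq_or_lt with h | h
  · exact .inr (Prod.ext h hw1)
  · exact .inl (Prod.ext (le_antisymm (hmax w (Finset.mem_filter.2 ⟨hw, hw1, h⟩)) hyw.1)
      (hw1.trans hy1.symm))

theorem HasRight.exists_successive {S : Finset (α × β)} {x : α × β} (hx : x ∈ S)
    (h : HasRight S x) : ∃ y, Successive S x y ∧ x.2 = y.2 := by
  obtain ⟨r, hr, hr'⟩ := h
  obtain ⟨y, hy, hmin⟩ := (S.filter fun y => y.2 = x.2 ∧ x.1 < y.1).exists_min_image Prod.fst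
    ⟨(r, x.2), by simp [hr, hr']⟩
  obtain ⟨hy, hy1, hy2⟩ := Finset.mem_filter.1 hy
  refine ⟨y, ⟨hx, hy, Prod.lt_iff.2 (.inl ⟨hy2, hy1.ge⟩), fun w hw hyw hwx => ?_⟩, hy1.symm⟩
  have hw1 : w.2 = x.2 := le_antisymm (hy1 ▸ hwx.2) hyw.2
  rcases hyw.1.eq_or_lt with h | h
  · exact .inl (Prod.ext h.symm hw1)
  · exact .inr (Prod.ext (le_antisymm hwx.1 (hmin w (Finset.mem_filter.2 ⟨hw, hw1, h⟩)))
      (hw1.trans hy1.symm))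

theorem Successive.hasBelow {S : Finset (α × β)} {y x : α × β} (h : Successive S y x)
    (h1 : y.1 = x.1) : HasBelow S x :=
  ⟨y.2, ((Prod.lt_iff.1 h.2.2.1).resolve_left fun h' => h'.1.ne h1).2, h1 ▸ h.1⟩

theorem Successive.hasLeft {S : Finset (α × β)} {y x : α × β} (h : Successive S y x)
    (h1 : y.2 = x.2) : HasLeft S x :=
  ⟨y.1, ((Prod.lt_iff.1 h.2.2.1).resolve_right fun h' => h'.2.ne h1).1, h1 ▸ h.1⟩

theorem Successive.hasAbove {S : Finset (α × β)} {y x : α × β} (h : Successive S x y)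
    (h1 : x.1 = y.1) : HasAbove S x :=
  ⟨y.2, ((Prod.lt_iff.1 h.2.2.1).resolve_left fun h' => h'.1.ne h1).2, h1 ▸ h.2.1⟩

theorem Successive.hasRight {S : Finset (α × β)} {y x : α × β} (h : Successive S x y)
    (h1 : x.2 = y.2) : HasRight S x :=
  ⟨y.1, ((Prod.lt_iff.1 h.2.2.1).resolve_right fun h' => h'.2.ne h1).1, h1 ▸ h.2.1⟩

end Staircase

/-! ### `Z` and `S` in coordinates -/

section Forms

variable {n : ℕ}

theorem FormsZ.symm {m e k : Sym2 (Fin n)} (h : FormsZ m e k) : FormsZ k e m := by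
  obtain ⟨u, v, w, x, rfl, rfl, rfl, h⟩ := h
  refine ⟨x, w, v, u, Sym2.eq_swap, Sym2.eq_swap, Sym2.eq_swap, ?_⟩
  rcases h with h | h | h | h <;> simp only [Clockwise, h, and_self, true_or, or_true]

theorem FormsS.symm {m e k : Sym2 (Fin n)} (h : FormsS m e k) : FormsS k e m := by
  obtain ⟨u, v, w, x, rfl, rfl, rfl, h⟩ := h
  refine ⟨x, w, v, u, Sym2.eq_swap, Sym2.eq_swap, Sym2.eq_swap, ?_⟩
  rcases h with h | h | h | h <;> simp only [Clockwise, h, and_self, true_or, or_true]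

/-- Some coordinate increases strictly from `y` to `w`, and some coordinate from `w` to `x`. The
endpoints carrying these coordinates lie strictly before and strictly after the chord of `w`. -/
theorem exists_separated {a b : Fin n} {y w x : Fin n × Fin n}
    (hy : Admissible a b y) (hw : Admissible a b w) (hx : Admissible a b x)
    (hyw : y < w) (hwx : w < x) :
    ∃ u ∈ pairEdge a y, ∃ v ∈ pairEdge a x, HollowCross s(u, v) (pairEdge a w) := by
  simp only [pairEdge, Sym2.mem_iff, exists_eq_or_imp, exists_eq_left, hollowCross_mk]
  obtain ⟨y1, y2⟩ := y
  obtain ⟨w1, w2⟩ := w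
  obtain ⟨x1, x2⟩ := x
  simp only [Prod.lt_iff, Admissible, Fin.lt_def, Fin.le_def] at *
  have h : ((y1 : ℕ) < w1 ∧ (w1 : ℕ) < x1) ∨ ((y1 : ℕ) < w1 ∧ (w2 : ℕ) < x2) ∨
      ((y2 : ℕ) < w2 ∧ (w1 : ℕ) < x1) ∨ ((y2 : ℕ) < w2 ∧ (w2 : ℕ) < x2) := by omega
  rcases h with h | h | h | h
  · refine .inl (.inl ?_)
    simp only [val_stepBack]
    unfold Alternate Clockwise
    split_ifs <;> omega
  · refine .inl (.inr ?_)
    simp only [val_stepBack]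
    unfold Alternate Clockwise
    split_ifs <;> omega
  · refine .inr (.inl ?_)
    simp only [val_stepBack]
    unfold Alternate Clockwise
    split_ifs <;> omega
  · refine .inr (.inr ?_)
    simp only [val_stepBack]
    unfold Alternate Clockwise
    split_ifs <;> omega

theorem formsZ_iff {a b : Fin n} {y x z : Fin n × Fin n}
    (hy : Admissible a b y) (hx : Admissible a b x) (hz : Admissible a b z)
    (hyx : y < x) (hxz : x < z) :
    FormsZ (pairEdge a y) (pairEdge a x) (pairEdge a z) ↔ y.1 = x.1 ∧ x.2 = z.2 := by
  constructor
  · rintro ⟨u, v, w, t, h1, h2, h3, h⟩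
    have hu : v ∈ pairEdge a y := by simp [h1]
    have hw : w ∈ pairEdge a z := by simp [h3]
    rw [pairEdge, Sym2.eq_iff] at h2
    rcases h2 with ⟨rfl, rfl⟩ | ⟨rfl, rfl⟩
    · simp only [pairEdge, Sym2.mem_iff] at hu hw
      exact ⟨(hu.resolve_right (stepBack_ne hy hx).symm).symm,
        stepBack_injective a (hw.resolve_left (stepBack_ne hx hz))⟩
    -- Read in the other direction along the middle edge, the path is an `S`, which contradicts the
    -- clockwise order `h`.
    · simp only [pairEdge, Sym2.mem_iff] at hu hw
      have e1 := stepBack_injective a (hu.resolve_left (stepBack_ne hx hy))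
      have e2 := hw.resolve_right (stepBack_ne hz hx).symm
      obtain ⟨y1, y2⟩ := y
      obtain ⟨x1, x2⟩ := x
      obtain ⟨z1, z2⟩ := z
      obtain rfl : x2 = y2 := e1
      obtain rfl : x1 = z1 := e2
      rw [pairEdge, Sym2.congr_left] at h1
      rw [pairEdge, Sym2.congr_right] at h3
      subst h1 h3
      simp only [Prod.lt_iff, Admissible, Fin.lt_def, Fin.le_def, hollowLabel, Clockwise,
        val_stepBack] at *
      exfalso
      split_ifs at h <;> omega
  · rintro ⟨e1, e2⟩
    obtain ⟨y1, y2⟩ := y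
    obtain ⟨x1, x2⟩ := x
    obtain ⟨z1, z2⟩ := z
    obtain rfl : y1 = x1 := e1
    obtain rfl : x2 = z2 := e2
    refine ⟨stepBack a y2, y1, stepBack a x2, z1, Sym2.eq_swap, rfl, Sym2.eq_swap, ?_⟩
    simp only [Prod.lt_iff, Admissible, Fin.lt_def, Fin.le_def, hollowLabel, Clockwise,
      val_stepBack] at *
    split_ifs <;> omega

theorem formsS_iff {a b : Fin n} {y x z : Fin n × Fin n}
    (hy : Admissible a b y) (hx : Admissible a b x) (hz : Admissible a b z)
    (hyx : y < x) (hxz : x < z) :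
    FormsS (pairEdge a y) (pairEdge a x) (pairEdge a z) ↔ y.2 = x.2 ∧ x.1 = z.1 := by
  constructor
  · rintro ⟨u, v, w, t, h1, h2, h3, h⟩
    have hu : v ∈ pairEdge a y := by simp [h1]
    have hw : w ∈ pairEdge a z := by simp [h3]
    rw [pairEdge, Sym2.eq_iff] at h2
    rcases h2 with ⟨rfl, rfl⟩ | ⟨rfl, rfl⟩
    · simp only [pairEdge, Sym2.mem_iff] at hu hw
      have e1 := hu.resolve_right (stepBack_ne hy hx).symm
      have e2 := stepBack_injective a (hw.resolve_left (stepBack_ne hx hz))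
      obtain ⟨y1, y2⟩ := y
      obtain ⟨x1, x2⟩ := x
      obtain ⟨z1, z2⟩ := z
      obtain rfl : x1 = y1 := e1
      obtain rfl : x2 = z2 := e2
      rw [pairEdge, Sym2.eq_swap, Sym2.congr_left] at h1
      rw [pairEdge, Sym2.eq_swap, Sym2.congr_right] at h3
      subst h1 h3
      simp only [Prod.lt_iff, Admissible, Fin.lt_def, Fin.le_def, hollowLabel, Clockwise,
        val_stepBack] at *
      exfalso
      split_ifs at h <;> omega
    · simp only [pairEdge, Sym2.mem_iff] at hu hw
      exact ⟨(stepBack_injective a (hu.resolve_left (stepBack_ne hx hy))).symm,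
        hw.resolve_right (stepBack_ne hz hx).symm⟩
  · rintro ⟨e1, e2⟩
    obtain ⟨y1, y2⟩ := y
    obtain ⟨x1, x2⟩ := x
    obtain ⟨z1, z2⟩ := z
    obtain rfl : y2 = x2 := e1
    obtain rfl : x1 = z1 := e2
    refine ⟨y1, stepBack a y2, x1, stepBack a z2, rfl, Sym2.eq_swap, rfl, ?_⟩
    simp only [Prod.lt_iff, Admissible, Fin.lt_def, Fin.le_def, hollowLabel, Clockwise,
      val_stepBack] at *
    split_ifs <;> omega

end Forms

/-! ### Cells, neighbours and the sign of a turn -/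

namespace HollowDissection

variable {n : ℕ} (D : HollowDissection n)

/-- No two of the vertices of `C` are separated by a diagonal of the dissection. -/
def Unseparated (C : Set (Fin n)) : Prop :=
  ∀ v ∈ C, ∀ w ∈ C, ∀ e ∈ D.diagonals, ¬ HollowCross s(v, w) e

theorem exists_isCell {C : Set (Fin n)} (hC : D.Unseparated C) :
    ∃ C', C ⊆ C' ∧ D.IsCell C' := by
  obtain ⟨C', h, h'⟩ := (Set.toFinite {C : Set (Fin n) | D.Unseparated C}).exists_le_maximal hC
  exact ⟨C', h, h'⟩

/-- Suppose a diagonal separates a vertex of `C` from one of `C'`. It has only two endpoints, so it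
misses one of the three common vertices, and it separates that one from one of the two, inside a
single cell. Thus the union is unseparated, and maximality applies. -/
theorem IsCell.eq_of_three {C C' : Set (Fin n)} (hC : D.IsCell C) (hC' : D.IsCell C')
    {u v w : Fin n} (huv : u ≠ v) (huw : u ≠ w) (hvw : v ≠ w) (hu : u ∈ C ∩ C')
    (hv : v ∈ C ∩ C') (hw : w ∈ C ∩ C') : C = C' := by
  have key : ∀ x ∈ C, ∀ y ∈ C', ∀ e ∈ D.diagonals, ¬ HollowCross s(x, y) e := by
    intro x hx y hy e he h
    induction e with | _ s t
    obtain ⟨c, hc, hcs, hct⟩ : ∃ c ∈ C ∩ C', c ≠ s ∧ c ≠ t := by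
      by_cases h1 : u ≠ s ∧ u ≠ t
      · exact ⟨u, hu, h1⟩
      by_cases h2 : v ≠ s ∧ v ≠ t
      · exact ⟨v, hv, h2⟩
      refine ⟨w, hw, ?_, ?_⟩ <;> rintro rfl <;> grind
    rw [hollowCross_mk] at h
    rcases h.comm.separates (c := c) (by rwa [ne_eq, ← Fin.ext_iff])
      (by rwa [ne_eq, ← Fin.ext_iff]) with h | h
    · exact hC.prop c hc.1 x hx _ he ((hollowCross_mk _ _ _ _).2 h.comm)
    · exact hC'.prop c hc.2 y hy _ he ((hollowCross_mk _ _ _ _).2 h.comm)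
  have hU : D.Unseparated (C ∪ C') := by
    rintro x (hx | hx) y (hy | hy) e he
    · exact hC.prop x hx y hy e he
    · exact key x hx y hy e he
    · rw [Sym2.eq_swap]
      exact key y hy x hx e he
    · exact hC'.prop x hx y hy e he
  exact Set.Subset.antisymm
    (Set.subset_union_left.trans (hC'.2 hU Set.subset_union_right))
    (Set.subset_union_right.trans (hC.2 hU Set.subset_union_left))

variable {a b : Fin n}

/-- The two edges span a triangle. A diagonal crossing its third side but neither of the two edges
must end at their common vertex; it then gives a point strictly between `y` and `x` on the
staircase. -/
theorem unseparated_of_successive (hab : a < b) {y x : Fin n × Fin n}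
    (h : Successive (D.pairs a b) y x) (hyx : y.1 = x.1 ∨ y.2 = x.2) :
    D.Unseparated {v | v ∈ pairEdge a y ∨ v ∈ pairEdge a x} := by
  obtain ⟨hy, hx, hlt, hbet⟩ := h
  have noncross : ∀ w ∈ D.pairs a b, ∀ e ∈ D.diagonals, ¬ HollowCross (pairEdge a w) e :=
    fun w hw e he => D.not_hollowCross (D.mem_pairs.1 hw).2 (.inl he)
  have loop : ∀ (v : Fin n) (e : Sym2 (Fin n)), ¬ HollowCross s(v, v) e := by
    intro v e h
    induction e with | _ s t
    rw [hollowCross_mk] at h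
    rcases h with (h | h | h | h) | (h | h | h | h) <;> omega
  obtain ⟨y1, y2⟩ := y
  obtain ⟨x1, x2⟩ := x
  have hy' := (D.mem_pairs.1 hy).1
  have hx' := (D.mem_pairs.1 hx).1
  have far : ∀ e ∈ D.diagonals, (y2 = x2 → ¬ HollowCross s(y1, x1) e) ∧
      (y1 = x1 → ¬ HollowCross s(stepBack a y2, stepBack a x2) e) := by
    intro e he
    have nc1 := noncross _ hy e he
    have nc2 := noncross _ hx e he
    constructor
    · rintro rfl h
      induction e with | _ s t
      rw [pairEdge, hollowCross_mk] at nc1 nc2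
      rw [hollowCross_mk] at h
      have hc : stepBack a y2 = s ∨ stepBack a y2 = t := by
        by_contra! hc
        rcases h.comm.separates (c := (stepBack a y2 : ℕ)) (by rw [ne_eq, ← Fin.ext_iff]; exact hc.1)
          (by rw [ne_eq, ← Fin.ext_iff]; exact hc.2) with h | h
        · exact nc1 h.comm.swap_left
        · exact nc2 h.comm.swap_left
      have fin : ∀ t : Fin n, s(t, stepBack a y2) ∈ D.diagonals →
          Alternate y1 x1 t (stepBack a y2) → False := by
        intro t ht h
        have hlt' : y1 < x1 := by
          rcases Prod.lt_iff.1 hlt with h | h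
          · exact h.1
          · exact absurd h.2 (lt_irrefl _)
        rw [alternate_iff hlt'] at h
        have hout := stepBack_outside.2 hy'.2.2
        have ht1 : y1 < t ∧ t < x1 := by
          simp only [Admissible, Fin.lt_def, Fin.le_def] at *
          omega
        have htS : (t, y2) ∈ D.pairs a b := D.mem_pairs.2
          ⟨⟨hy'.1.trans ht1.1, ht1.2.le.trans hx'.2.1, hy'.2.2⟩, .inl ht⟩
        rcases hbet _ htS ⟨ht1.1.le, le_rfl⟩ ⟨ht1.2.le, le_rfl⟩ with h | h
        · exact ht1.1.ne' (Prod.ext_iff.1 h).1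
        · exact ht1.2.ne (Prod.ext_iff.1 h).1
      rcases hc with rfl | rfl
      · exact fin t (Sym2.eq_swap ▸ he) h.swap_right
      · exact fin s he h
    · rintro rfl h
      induction e with | _ s t
      rw [pairEdge, hollowCross_mk] at nc1 nc2
      rw [hollowCross_mk] at h
      have hc : y1 = s ∨ y1 = t := by
        by_contra! hc
        rcases h.comm.separates (c := (y1 : ℕ)) (by rw [ne_eq, ← Fin.ext_iff]; exact hc.1)
          (by rw [ne_eq, ← Fin.ext_iff]; exact hc.2) with h | h
        · exact nc1 h.comm
        · exact nc2 h.comm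
      have fin : ∀ t : Fin n, s(y1, t) ∈ D.diagonals →
          Alternate (stepBack a y2) (stepBack a x2) y1 t → False := by
        intro t ht h
        have hlt' : y2 < x2 := by
          rcases Prod.lt_iff.1 hlt with h | h
          · exact absurd h.1 (lt_irrefl _)
          · exact h.2
        obtain ⟨r, rfl⟩ : ∃ r, stepBack a r = t := ⟨_, stepBack_stepBack a t⟩
        have ht1 : y2 < r ∧ r < x2 := by
          simp only [Admissible, Fin.lt_def, Fin.le_def, val_stepBack] at *
          have := r.2
          rcases h with (h | h | h | h) | (h | h | h | h) <;> split_ifs at h <;> omega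
        have htS : (y1, r) ∈ D.pairs a b := D.mem_pairs.2
          ⟨⟨hy'.1, hy'.2.1, lt_of_le_of_lt (by simpa using ht1.2.le) hx'.2.2⟩, .inl ht⟩
        rcases hbet _ htS ⟨le_rfl, ht1.1.le⟩ ⟨le_rfl, ht1.2.le⟩ with h | h
        · exact ht1.1.ne' (Prod.ext_iff.1 h).2
        · exact ht1.2.ne (Prod.ext_iff.1 h).2
      rcases hc with rfl | rfl
      · exact fin t he h
      · exact fin s (Sym2.eq_swap ▸ he) h.swap_right
  intro v hv w hw e he
  have h1 := noncross _ hy e he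
  have h2 := noncross _ hx e he
  have h3 := far e he
  simp only [pairEdge, Sym2.mem_iff, Set.mem_ofPred_eq] at *
  have sw : ∀ p q : Fin n, HollowCross s(p, q) e → HollowCross s(q, p) e := fun p q h =>
    Sym2.eq_swap ▸ h
  rcases hyx with rfl | rfl
  · have h3 := h3.2 rfl
    rcases hv with (rfl | rfl) | (rfl | rfl) <;> rcases hw with (rfl | rfl) | (rfl | rfl) <;>
      first
        | assumption | exact loop _ _ | exact fun h => h1 (sw _ _ h)
        | exact fun h => h2 (sw _ _ h) | exact fun h => h3 (sw _ _ h)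
  · have h3 := h3.1 rfl
    rcases hv with (rfl | rfl) | (rfl | rfl) <;> rcases hw with (rfl | rfl) | (rfl | rfl) <;>
      first
        | assumption | exact loop _ _ | exact fun h => h1 (sw _ _ h)
        | exact fun h => h2 (sw _ _ h) | exact fun h => h3 (sw _ _ h)

theorem pairs_total {x y : Fin n × Fin n} (hx : x ∈ D.pairs a b)
    (hy : y ∈ D.pairs a b) : x ≤ y ∨ y ≤ x := by
  rcases lt_trichotomy x.1 y.1 with h | h | h
  · exact .inl ⟨h.le, D.pairs_chain hx hy h⟩
  · rcases le_total x.2 y.2 with h' | h'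
    · exact .inl ⟨h.le, h'⟩
    · exact .inr ⟨h.ge, h'⟩
  · exact .inr ⟨h.le, D.pairs_chain hy hx h⟩

theorem successive_of_unseparated (hab : a < b) {C : Set (Fin n)} (hC : D.Unseparated C)
    {y x : Fin n × Fin n} (hy : y ∈ D.pairs a b) (hx : x ∈ D.pairs a b) (hyx : y < x)
    (hyC : ∀ v ∈ pairEdge a y, v ∈ C) (hxC : ∀ v ∈ pairEdge a x, v ∈ C) :
    Successive (D.pairs a b) y x := by
  refine ⟨hy, hx, hyx, fun w hw hyw hwx => ?_⟩
  by_contra! h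
  have hyw := lt_of_le_of_ne hyw h.1.symm
  have hwx := lt_of_le_of_ne hwx h.2
  obtain ⟨u, hu, v, hv, huv⟩ := exists_separated (D.mem_pairs.1 hy).1 (D.mem_pairs.1 hw).1
    (D.mem_pairs.1 hx).1 hyw hwx
  refine hC u (hyC u hu) v (hxC v hv) _ (D.pairEdge_mem_diagonals hab hw ?_ ?_) huv
  · rintro rfl
    exact absurd hyw (not_lt_of_ge (D.firstPair_le hab hy))
  · rintro rfl
    exact absurd hwx (not_lt_of_ge (D.le_lastPair hab hx))

/-- Two distinct crossed edges have at least three endpoints in all. -/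
theorem eq_of_common_cells {C C' : Set (Fin n)} (hC : D.IsCell C)
    (hC' : D.IsCell C') {y x : Fin n × Fin n} (hy : Admissible a b y) (hx : Admissible a b x)
    (hyx : y ≠ x) (hyC : ∀ v ∈ pairEdge a y, v ∈ C ∩ C')
    (hxC : ∀ v ∈ pairEdge a x, v ∈ C ∩ C') : C = C' := by
  have hx1 := hxC x.1 (by simp [pairEdge])
  have hx2 := hxC (stepBack a x.2) (by simp [pairEdge])
  by_cases h : y.1 = x.1
  · refine IsCell.eq_of_three D hC hC' (stepBack_ne hx hx).symm (stepBack_ne hy hx).symm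
      (fun h' => hyx (Prod.ext h (stepBack_injective a h').symm)) hx1 hx2
      (hyC _ (by simp [pairEdge]))
  · exact IsCell.eq_of_three D hC hC' (stepBack_ne hx hx).symm (Ne.symm h)
      (stepBack_ne hx hy) hx1 hx2 (hyC _ (by simp [pairEdge]))

theorem Neighbours.successive (hab : a < b) {m e k : Sym2 (Fin n)}
    (h : D.Neighbours s(a, b) m e k) :
    ∃ y x z, pairEdge a y = m ∧ pairEdge a x = e ∧ pairEdge a z = k ∧
      ((Successive (D.pairs a b) y x ∧ Successive (D.pairs a b) x z) ∨
        (Successive (D.pairs a b) z x ∧ Successive (D.pairs a b) x y)) := by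
  obtain ⟨he, hm, hk, hme, hke, C, C', hC, hC', hne, heC, heC', hmC, hkC'⟩ := h
  obtain ⟨y, hy, rfl⟩ := (D.mem_crossed_iff hab _).1 hm
  obtain ⟨x, hx, rfl⟩ := (D.mem_crossed_iff hab _).1 he
  obtain ⟨z, hz, rfl⟩ := (D.mem_crossed_iff hab _).1 hk
  have hyx : y ≠ x := fun h => hme (h ▸ rfl)
  have hzx : z ≠ x := fun h => hke (h ▸ rfl)
  have hyz : y ≠ z := by
    rintro rfl
    exact hne (D.eq_of_common_cells hC hC' (D.mem_pairs.1 hy).1 (D.mem_pairs.1 hx).1 hyx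
      (fun v hv => ⟨hmC v hv, hkC' v hv⟩) fun v hv => ⟨heC v hv, heC' v hv⟩)
  refine ⟨y, x, z, rfl, rfl, rfl, ?_⟩
  rcases D.pairs_total hy hx with h1 | h1 <;> rcases D.pairs_total hz hx with h2 | h2
  -- Both neighbours would be the immediate predecessor of `x`, hence equal.
  · exfalso
    have s1 := D.successive_of_unseparated hab hC.prop hy hx (lt_of_le_of_ne h1 hyx) hmC heC
    have s2 := D.successive_of_unseparated hab hC'.prop hz hx (lt_of_le_of_ne h2 hzx) hkC' heC'
    rcases D.pairs_total hy hz with h3 | h3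
    · exact (s1.2.2.2 z hz h3 h2).elim hyz.symm hzx
    · exact (s2.2.2.2 y hy h3 h1).elim hyz hyx
  · exact .inl ⟨D.successive_of_unseparated hab hC.prop hy hx (lt_of_le_of_ne h1 hyx) hmC heC,
      D.successive_of_unseparated hab hC'.prop hx hz (lt_of_le_of_ne h2 hzx.symm) heC' hkC'⟩
  · exact .inr ⟨D.successive_of_unseparated hab hC'.prop hz hx (lt_of_le_of_ne h2 hzx) hkC' heC',
      D.successive_of_unseparated hab hC.prop hx hy (lt_of_le_of_ne h1 hyx.symm) heC hmC⟩
  · exfalso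
    have s1 := D.successive_of_unseparated hab hC.prop hx hy (lt_of_le_of_ne h1 hyx.symm) heC hmC
    have s2 := D.successive_of_unseparated hab hC'.prop hx hz (lt_of_le_of_ne h2 hzx.symm)
      heC' hkC'
    rcases D.pairs_total hy hz with h3 | h3
    · exact (s2.2.2.2 y hy h1 h3).elim hyx hyz
    · exact (s1.2.2.2 z hz h2 h3).elim hzx hyz.symm

theorem neighbours_of_successive (hab : a < b) {y x z : Fin n × Fin n}
    (hyx : Successive (D.pairs a b) y x) (hxz : Successive (D.pairs a b) x z)
    (h1 : y.1 = x.1 ∨ y.2 = x.2) (h2 : x.1 = z.1 ∨ x.2 = z.2)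
    (hx : pairEdge a x ∈ D.diagonals) :
    D.Neighbours s(a, b) (pairEdge a y) (pairEdge a x) (pairEdge a z) := by
  obtain ⟨C, hC, hC'⟩ := D.exists_isCell (D.unseparated_of_successive hab hyx h1)
  obtain ⟨E, hE, hE'⟩ := D.exists_isCell (D.unseparated_of_successive hab hxz h2)
  have hy' := (D.mem_pairs.1 hyx.1).1
  have hx' := (D.mem_pairs.1 hyx.2.1).1
  have hz' := (D.mem_pairs.1 hxz.2.1).1
  refine ⟨(D.mem_crossed_iff hab _).2 ⟨x, hyx.2.1, rfl⟩,
    (D.mem_crossed_iff hab _).2 ⟨y, hyx.1, rfl⟩, (D.mem_crossed_iff hab _).2 ⟨z, hxz.2.1, rfl⟩,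
    fun h => hyx.2.2.1.ne (pairEdge_inj hy' hx' h),
    fun h => hxz.2.2.1.ne (pairEdge_inj hz' hx' h).symm, C, E, hC', hE', ?_,
    fun v hv => hC (.inr hv), fun v hv => hE (.inl hv), fun v hv => hC (.inl hv),
    fun v hv => hE (.inr hv)⟩
  -- The two cells differ because the diagonal of `x` separates an endpoint of `y` from an endpoint
  -- of `z`.
  rintro rfl
  obtain ⟨u, hu, v, hv, huv⟩ := exists_separated hy' hx' hz' hyx.2.2.1 hxz.2.2.1
  exact hC'.prop u (hC (.inl hu)) v (hE (.inr hv)) _ hx huv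

theorem formsZ_neighbours_iff (hab : a < b) {x : Fin n × Fin n} (hx : x ∈ D.pairs a b)
    (hxD : pairEdge a x ∈ D.diagonals) :
    (∃ m k, D.Neighbours s(a, b) m (pairEdge a x) k ∧ FormsZ m (pairEdge a x) k) ↔
      HasBelow (D.pairs a b) x ∧ HasRight (D.pairs a b) x := by
  have adm : ∀ w ∈ D.pairs a b, Admissible a b w := fun w hw => (D.mem_pairs.1 hw).1
  constructor
  · rintro ⟨m, k, h, hf⟩
    obtain ⟨y, x', z, rfl, he, rfl, ⟨h1, h2⟩ | ⟨h1, h2⟩⟩ := Neighbours.successive D hab h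
    · obtain rfl := pairEdge_inj (adm _ h1.2.1) (adm _ hx) he
      rw [formsZ_iff (adm _ h1.1) (adm _ hx) (adm _ h2.2.1) h1.2.2.1 h2.2.2.1] at hf
      exact ⟨h1.hasBelow hf.1, h2.hasRight hf.2⟩
    · obtain rfl := pairEdge_inj (adm _ h1.2.1) (adm _ hx) he
      have hf := hf.symm
      rw [formsZ_iff (adm _ h1.1) (adm _ hx) (adm _ h2.2.1) h1.2.2.1 h2.2.2.1] at hf
      exact ⟨h1.hasBelow hf.1, h2.hasRight hf.2⟩
  · rintro ⟨h1, h2⟩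
    obtain ⟨y, hy, hy'⟩ := h1.exists_successive hx
    obtain ⟨z, hz, hz'⟩ := h2.exists_successive hx
    exact ⟨_, _, D.neighbours_of_successive hab hy hz (.inl hy') (.inr hz') hxD,
      (formsZ_iff (adm _ hy.1) (adm _ hx) (adm _ hz.2.1) hy.2.2.1 hz.2.2.1).2 ⟨hy', hz'⟩⟩

theorem formsS_neighbours_iff (hab : a < b) {x : Fin n × Fin n} (hx : x ∈ D.pairs a b)
    (hxD : pairEdge a x ∈ D.diagonals) :
    (∃ m k, D.Neighbours s(a, b) m (pairEdge a x) k ∧ FormsS m (pairEdge a x) k) ↔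
      HasLeft (D.pairs a b) x ∧ HasAbove (D.pairs a b) x := by
  have adm : ∀ w ∈ D.pairs a b, Admissible a b w := fun w hw => (D.mem_pairs.1 hw).1
  constructor
  · rintro ⟨m, k, h, hf⟩
    obtain ⟨y, x', z, rfl, he, rfl, ⟨h1, h2⟩ | ⟨h1, h2⟩⟩ := Neighbours.successive D hab h
    · obtain rfl := pairEdge_inj (adm _ h1.2.1) (adm _ hx) he
      rw [formsS_iff (adm _ h1.1) (adm _ hx) (adm _ h2.2.1) h1.2.2.1 h2.2.2.1] at hf
      exact ⟨h1.hasLeft hf.1, h2.hasAbove hf.2⟩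
    · obtain rfl := pairEdge_inj (adm _ h1.2.1) (adm _ hx) he
      have hf := hf.symm
      rw [formsS_iff (adm _ h1.1) (adm _ hx) (adm _ h2.2.1) h1.2.2.1 h2.2.2.1] at hf
      exact ⟨h1.hasLeft hf.1, h2.hasAbove hf.2⟩
  · rintro ⟨h1, h2⟩
    obtain ⟨y, hy, hy'⟩ := h1.exists_successive hx
    obtain ⟨z, hz, hz'⟩ := h2.exists_successive hx
    exact ⟨_, _, D.neighbours_of_successive hab hy hz (.inr hy') (.inl hz') hxD,
      (formsS_iff (adm _ hy.1) (adm _ hx) (adm _ hz.2.1) hy.2.2.1 hz.2.2.1).2 ⟨hy', hz'⟩⟩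

theorem ne_firstPair (hab : a < b) {x : Fin n × Fin n} (hxD : pairEdge a x ∈ D.diagonals) :
    x ≠ firstPair hab := by
  rintro rfl
  exact (D.internal _ hxD).2 (isBoundaryEdge_firstPair hab)

theorem ne_lastPair (hab : a < b) {x : Fin n × Fin n} (hxD : pairEdge a x ∈ D.diagonals) :
    x ≠ lastPair hab := by
  rintro rfl
  exact (D.internal _ hxD).2 (isBoundaryEdge_lastPair hab)

-- A diagonal of `D` is neither end of the staircase, so exactly one of left and below and exactly
-- one of right and above occurs. A `Z` is below-right, an `S` is left-above, and on a straight
-- passage the two indicators agree.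
open Classical in
theorem slalomSign_pairEdge (hab : a < b) (hD : D.IsAccordionDiagonal s(a, b))
    {x : Fin n × Fin n} (hx : x ∈ D.pairs a b) (hxD : pairEdge a x ∈ D.diagonals) :
    D.slalomSign (pairEdge a x) s(a, b) =
      (if HasRight (D.pairs a b) x then 1 else 0) -
        (if HasLeft (D.pairs a b) x then 1 else 0) := by
  have hS := D.isStaircase_pairs hab hD
  simp only [slalomSign, D.formsZ_neighbours_iff hab hx hxD, D.formsS_neighbours_iff hab hx hxD]
  have h1 : HasLeft (D.pairs a b) x ↔ ¬ HasBelow (D.pairs a b) x :=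
    ⟨fun h h' => hS.not_left_and_below h h',
      (hS.prev x hx (D.ne_firstPair hab hxD)).resolve_right⟩
  have h2 : HasAbove (D.pairs a b) x ↔ ¬ HasRight (D.pairs a b) x :=
    ⟨fun h h' => hS.not_right_and_above h' h,
      (hS.next x hx (D.ne_lastPair hab hxD)).resolve_left⟩
  simp only [h1, h2]
  by_cases h3 : HasBelow (D.pairs a b) x <;> by_cases h4 : HasRight (D.pairs a b) x <;>
    simp [h3, h4]

theorem slalomSign_of_not_crossed {e g : Sym2 (Fin n)} (h : e ∉ D.crossed g) :
    D.slalomSign e g = 0 := by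
  rw [slalomSign, if_neg fun ⟨_, _, h', _⟩ => h h'.1, if_neg fun ⟨_, _, h', _⟩ => h h'.1]

end HollowDissection

/-! ### Rotated diagonals and crossing numbers -/

section Rotation

variable {n : ℕ}

/-- The solid diagonal obtained by moving the endpoints of a hollow diagonal to the preceding
solid vertices. -/
def counterclockwise (e : Sym2 (Fin n)) : Sym2 (Fin n) := e.map (finRotate n).symm

theorem counterclockwise_mk (u v : Fin n) :
    counterclockwise s(u, v) = s((finRotate n).symm u, (finRotate n).symm v) := rfl

theorem map_finRotate_counterclockwise (e : Sym2 (Fin n)) :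
    (counterclockwise e).map (finRotate n) = e := by
  rw [counterclockwise, Sym2.map_map, Equiv.self_comp_symm, Sym2.map_id, id]

theorem counterclockwise_injective : Function.Injective (counterclockwise (n := n)) :=
  Function.LeftInverse.injective map_finRotate_counterclockwise

theorem val_finRotate_symm (i : Fin n) :
    (((finRotate n).symm i : Fin n) : ℕ) = if (i : ℕ) = 0 then n - 1 else (i : ℕ) - 1 := by
  have h := val_finRotate ((finRotate n).symm i)
  rw [Equiv.apply_symm_apply] at h
  have := ((finRotate n).symm i).2
  split_ifs at h ⊢ <;> omega

theorem exists_lt_of_not_isDiag {e : Sym2 (Fin n)} (h : ¬ e.IsDiag) :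
    ∃ a b : Fin n, a < b ∧ e = s(a, b) := by
  induction e with | _ u v
  rcases lt_trichotomy u v with huv | huv | huv
  · exact ⟨u, v, huv, rfl⟩
  · exact absurd (Sym2.mk_isDiag_iff.2 huv) h
  · exact ⟨v, u, huv, Sym2.eq_swap⟩

theorem solidCross_iff_hollowCross {e f : Sym2 (Fin n)} : SolidCross e f ↔ HollowCross e f := by
  induction e with | _ u v
  induction f with | _ p q
  rw [solidCross_mk, hollowCross_mk]

theorem not_solidCross_of_isDiag {e f : Sym2 (Fin n)} (h : e.IsDiag) : ¬ SolidCross e f := by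
  induction e with | _ u v
  induction f with | _ p q
  obtain rfl := Sym2.mk_isDiag_iff.1 h
  rw [solidCross_mk]
  rintro ((h | h | h | h) | (h | h | h | h)) <;> omega

theorem IsBoundaryEdge.counterclockwise {e : Sym2 (Fin n)} (h : IsBoundaryEdge e) :
    IsBoundaryEdge (counterclockwise e) := by
  obtain ⟨i, rfl⟩ := h
  exact ⟨(finRotate n).symm i, by
    rw [counterclockwise_mk, Equiv.symm_apply_apply, Equiv.apply_symm_apply]⟩

theorem Clockwise.rotate {p q x y : Fin n} (h : Clockwise p q x y) :
    Clockwise (finRotate n p) (finRotate n q) (finRotate n x) (finRotate n y) := by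
  simp only [val_finRotate]
  have := p.2
  have := q.2
  have := x.2
  have := y.2
  rcases h with h | h | h | h <;> unfold Clockwise <;> split_ifs <;> omega

theorem hollowCross_of_counterclockwise {e f : Sym2 (Fin n)}
    (h : SolidCross (counterclockwise e) (counterclockwise f)) : HollowCross e f := by
  induction e with | _ u v
  induction f with | _ p q
  rw [counterclockwise_mk, counterclockwise_mk, solidCross_mk] at h
  rw [hollowCross_mk]
  exact h.imp (fun h => by simpa only [Equiv.apply_symm_apply] using h.rotate)
    (fun h => by simpa only [Equiv.apply_symm_apply] using h.rotate)

open Classical in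
/-- The number of crossings of two solid diagonals. -/
noncomputable def crossNumber (h g : Sym2 (Fin n)) : ℝ := if SolidCross h g then 1 else 0

theorem crossNumber_boundary {h g : Sym2 (Fin n)} (hg : IsBoundaryEdge g) :
    crossNumber h g = 0 :=
  if_neg fun h' => not_hollowCross_boundary hg (solidCross_iff_hollowCross.1 h').symm

/-- A chord crossing one side crosses a diagonal (`Alternate.uncross`), and a chord crossing two
opposite sides crosses both diagonals (`Alternate.uncross'`). -/
theorem crossNumber_quadrilateral (h : Sym2 (Fin n)) {x y z w : Fin n}
    (hc : Clockwise x y z w) :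
    crossNumber h s(x, y) + crossNumber h s(z, w) ≤
      crossNumber h s(x, z) + crossNumber h s(y, w) := by
  by_cases hd : h.IsDiag
  · simp [crossNumber, not_solidCross_of_isDiag hd]
  obtain ⟨p, q, hpq, rfl⟩ := exists_lt_of_not_isDiag hd
  have hpq : (p : ℕ) < q := hpq
  classical
  simp only [crossNumber, solidCross_mk]
  by_cases h1 : Alternate p q x y
  · by_cases h2 : Alternate p q z w
    · simp [h1, h2, (h1.uncross' hpq hc h2).1, (h1.uncross' hpq hc h2).2]
    · rcases h1.uncross hpq hc with h3 | h3
      · simp only [h1, h2, h3, if_true, if_false]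
        split_ifs <;> norm_num
      · simp only [h1, h2, h3, if_true, if_false]
        split_ifs <;> norm_num
  · by_cases h2 : Alternate p q z w
    · have hc' : Clockwise z w x y := by
        rcases hc with h | h | h | h <;> simp only [Clockwise, h, and_self, true_or, or_true]
      rcases h2.uncross hpq hc' with h3 | h3
      · simp only [h1, h2, h3.swap_right, if_true, if_false]
        split_ifs <;> norm_num
      · simp only [h1, h2, h3.swap_right, if_true, if_false]
        split_ifs <;> norm_num
    · simp only [h1, h2, if_false]
      split_ifs <;> norm_num

end Rotation

/-! ### Inequalities and turns for one accordion diagonal -/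

namespace HollowDissection

variable {n : ℕ} (D : HollowDissection n) {a b : Fin n}

theorem not_solidCross_counterclockwise {e f : Sym2 (Fin n)} (he : e ∈ D.diagonals)
    (hf : f ∈ D.diagonals) : ¬ SolidCross (counterclockwise e) (counterclockwise f) :=
  fun h => D.noncrossing e he f hf (hollowCross_of_counterclockwise h)

theorem not_solidCross {e f : Sym2 (Fin n)} (he : e ∈ D.diagonals)
    (hf : f ∈ D.diagonals) : ¬ SolidCross e f :=
  fun h => D.noncrossing e he f hf (solidCross_iff_hollowCross.1 h)

theorem slalomSign_eq (e g : Sym2 (Fin n)) :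
    D.slalomSign e g = 1 ∨ D.slalomSign e g = -1 ∨ D.slalomSign e g = 0 := by
  unfold slalomSign
  split_ifs <;> simp

theorem exists_pair_of_slalomSign_ne_zero (hab : a < b) {e : Sym2 (Fin n)}
    (h : D.slalomSign e s(a, b) ≠ 0) : ∃ x ∈ D.pairs a b, pairEdge a x = e :=
  (D.mem_crossed_iff hab e).1 (not_not.1 fun h' => h (D.slalomSign_of_not_crossed h'))

theorem slalomSign_eq_one_iff (hab : a < b) (hD : D.IsAccordionDiagonal s(a, b))
    {x : Fin n × Fin n} (hx : x ∈ D.pairs a b) (hxD : pairEdge a x ∈ D.diagonals) :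
    D.slalomSign (pairEdge a x) s(a, b) = 1 ↔
      HasBelow (D.pairs a b) x ∧ HasRight (D.pairs a b) x := by
  have hS := D.isStaircase_pairs hab hD
  rw [D.slalomSign_pairEdge hab hD hx hxD]
  have h1 : HasLeft (D.pairs a b) x ↔ ¬ HasBelow (D.pairs a b) x :=
    ⟨fun h h' => hS.not_left_and_below h h',
      (hS.prev x hx (D.ne_firstPair hab hxD)).resolve_right⟩
  classical
  simp only [h1]
  by_cases h3 : HasBelow (D.pairs a b) x <;> by_cases h4 : HasRight (D.pairs a b) x <;>
    norm_num [h3, h4]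

theorem slalomSign_eq_neg_one_iff (hab : a < b) (hD : D.IsAccordionDiagonal s(a, b))
    {x : Fin n × Fin n} (hx : x ∈ D.pairs a b) (hxD : pairEdge a x ∈ D.diagonals) :
    D.slalomSign (pairEdge a x) s(a, b) = -1 ↔
      HasLeft (D.pairs a b) x ∧ HasAbove (D.pairs a b) x := by
  have hS := D.isStaircase_pairs hab hD
  rw [D.slalomSign_pairEdge hab hD hx hxD]
  have h1 : HasAbove (D.pairs a b) x ↔ ¬ HasRight (D.pairs a b) x :=
    ⟨fun h h' => hS.not_right_and_above h' h,
      (hS.next x hx (D.ne_lastPair hab hxD)).resolve_left⟩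
  classical
  simp only [h1]
  by_cases h3 : HasLeft (D.pairs a b) x <;> by_cases h4 : HasRight (D.pairs a b) x <;>
    norm_num [h3, h4]

theorem pairEdge_mem_diagonals_of_turn (hab : a < b) {x : Fin n × Fin n}
    (hx : x ∈ D.pairs a b) (h1 : HasLeft (D.pairs a b) x ∨ HasBelow (D.pairs a b) x)
    (h2 : HasRight (D.pairs a b) x ∨ HasAbove (D.pairs a b) x) :
    pairEdge a x ∈ D.diagonals := by
  refine D.pairEdge_mem_diagonals hab hx ?_ ?_
  · rintro rfl
    rcases h1 with ⟨i, hi, hi'⟩ | ⟨i, hi, hi'⟩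
    · exact absurd (D.firstPair_le hab hi').1 (not_le.2 hi)
    · exact absurd (D.firstPair_le hab hi').2 (not_le.2 hi)
  · rintro rfl
    rcases h2 with ⟨i, hi, hi'⟩ | ⟨i, hi, hi'⟩
    · exact absurd (D.le_lastPair hab hi').1 (not_le.2 hi)
    · exact absurd (D.le_lastPair hab hi').2 (not_le.2 hi)

/-- Transfer of `IsStaircase.sum_turn_le` to sums over `D`. The staircase also contains the two
boundary edges, which are not coordinates, so `φ` has to vanish there. -/
theorem sum_slalomSign_le (hab : a < b) (hD : D.IsAccordionDiagonal s(a, b))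
    (φ : Sym2 (Fin n) → ℝ) (ψ : Fin n → ℝ) (hφ : ∀ e, IsBoundaryEdge e → φ e = 0)
    (h : ∀ i j r, Admissible a b (i, r) → Admissible a b (j, r) → i < j →
      φ (pairEdge a (i, r)) - φ (pairEdge a (j, r)) ≤ ψ j - ψ i) :
    ∑ e ∈ D.diagonals, D.slalomSign e s(a, b) * φ e ≤ ψ b - ψ (firstPair hab).1 := by
  classical
  refine le_of_eq_of_le ?_ ((D.isStaircase_pairs hab hD).sum_turn_le
    (fun x => φ (pairEdge a x)) ψ fun i j r hi hj => h i j r (D.mem_pairs.1 hi).1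
      (D.mem_pairs.1 hj).1)
  set T := (D.pairs a b).filter fun x => pairEdge a x ∈ D.diagonals with hT
  have inj : Set.InjOn (pairEdge a) T := fun x hx y hy hxy =>
    pairEdge_inj (D.mem_pairs.1 (Finset.mem_filter.1 hx).1).1
      (D.mem_pairs.1 (Finset.mem_filter.1 hy).1).1 hxy
  calc ∑ e ∈ D.diagonals, D.slalomSign e s(a, b) * φ e
      = ∑ e ∈ T.image (pairEdge a), D.slalomSign e s(a, b) * φ e := by
        symm
        refine Finset.sum_subset ?_ ?_
        · intro e he
          obtain ⟨x, hx, rfl⟩ := Finset.mem_image.1 he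
          exact (Finset.mem_filter.1 hx).2
        · intro e he he'
          by_cases h0 : D.slalomSign e s(a, b) = 0
          · rw [h0, zero_mul]
          · obtain ⟨x, hx, rfl⟩ := D.exists_pair_of_slalomSign_ne_zero hab h0
            exact absurd (Finset.mem_image_of_mem _ (Finset.mem_filter.2 ⟨hx, he⟩)) he'
    _ = ∑ x ∈ T, D.slalomSign (pairEdge a x) s(a, b) * φ (pairEdge a x) :=
        Finset.sum_image inj
    _ = ∑ x ∈ T, ((if HasRight (D.pairs a b) x then (1 : ℝ) else 0) -
          (if HasLeft (D.pairs a b) x then 1 else 0)) * φ (pairEdge a x) := by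
        refine Finset.sum_congr rfl fun x hx => ?_
        obtain ⟨hx, hxD⟩ := Finset.mem_filter.1 hx
        rw [D.slalomSign_pairEdge hab hD hx hxD]
    _ = _ := by
        refine Finset.sum_subset (Finset.filter_subset _ _) fun x hx hx' => ?_
        rw [hφ _ ((D.mem_pairs.1 hx).2.resolve_left fun h =>
          hx' (Finset.mem_filter.2 ⟨hx, h⟩)), mul_zero]

/-- The potential `ψ` counts, negatively, crossings with the chord from the rotated vertex to `b`.
Its increments are controlled by the quadrilateral on two rotated vertices, the rotated far vertex
and `b`; its end values are the crossings with a boundary edge, which are zero, and those with `s(a,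
b)`. -/
theorem sum_slalomSign_counterclockwise_le {g : Sym2 (Fin n)} (hg : D.IsAccordionDiagonal g)
    (h : Sym2 (Fin n)) :
    ∑ e ∈ D.diagonals, D.slalomSign e g * crossNumber h (counterclockwise e) ≤
      crossNumber h g := by
  obtain ⟨a, b, hab, rfl⟩ := exists_lt_of_not_isDiag hg.1
  refine (D.sum_slalomSign_le hab hg (fun e => crossNumber h (counterclockwise e))
    (fun i => - crossNumber h s((finRotate n).symm i, b))
    (fun e he => crossNumber_boundary he.counterclockwise) ?_).trans_eq ?_
  · intro i j r hi hj hij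
    simp only [pairEdge, counterclockwise_mk]
    -- If the rotated far vertex is `b`, the quadrilateral degenerates and equality holds.
    by_cases hb : (finRotate n).symm (stepBack a r) = b
    · rw [hb]; linarith
    · have := crossNumber_quadrilateral h (x := (finRotate n).symm j) (y := b)
        (z := (finRotate n).symm (stepBack a r)) (w := (finRotate n).symm i) ?_
      · rw [Sym2.eq_swap (a := (finRotate n).symm (stepBack a r)) (b := (finRotate n).symm i),
          Sym2.eq_swap (a := b) (b := (finRotate n).symm i)] at this
        linarith
      · simp only [Admissible, Fin.ext_iff, Fin.lt_def, Fin.le_def, val_finRotate_symm,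
          val_stepBack, Clockwise] at *
        have := r.2
        split_ifs at * <;> omega
  · have h1 : IsBoundaryEdge s((finRotate n).symm b, b) := ⟨(finRotate n).symm b, by
      rw [Equiv.apply_symm_apply]⟩
    have h2 : (finRotate n).symm (firstPair hab).1 = a := by
      ext
      rw [val_finRotate_symm]
      simp [firstPair]
    rw [crossNumber_boundary h1, h2]
    ring

/-- Mirror image of the preceding inequality: the chords of the potential now start at `a`, and the
quadrilateral has vertices `a`, `i`, `j` and the far vertex. -/
theorem neg_sum_slalomSign_le {g : Sym2 (Fin n)} (hg : D.IsAccordionDiagonal g)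
    (h : Sym2 (Fin n)) :
    ∑ e ∈ D.diagonals, D.slalomSign e g * - crossNumber h e ≤ crossNumber h g := by
  obtain ⟨a, b, hab, rfl⟩ := exists_lt_of_not_isDiag hg.1
  refine (D.sum_slalomSign_le hab hg (fun e => - crossNumber h e)
    (fun i => crossNumber h s(a, i)) (fun e he => by rw [crossNumber_boundary he, neg_zero])
    ?_).trans_eq ?_
  · intro i j r hi hj hij
    simp only [pairEdge]
    by_cases hb : stepBack a r = a
    · rw [hb, Sym2.eq_swap (a := i), Sym2.eq_swap (a := j)]; linarith
    · have := crossNumber_quadrilateral h (x := a) (y := i) (z := j) (w := stepBack a r) ?_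
      · linarith
      · simp only [Admissible, Fin.ext_iff, Fin.lt_def, Fin.le_def, val_stepBack,
          Clockwise] at *
        have := r.2
        split_ifs at * <;> omega
  · have h1 : IsBoundaryEdge s(a, (firstPair hab).1) := ⟨a, by
      congr 2
      ext
      rw [val_finRotate, if_neg (by omega)]
      rfl⟩
    rw [crossNumber_boundary h1, sub_zero]

/-- At an `S`, the point to the left keeps the near rotated endpoint off `a`, and the point above
keeps the far one off `b`; the crossing is therefore proper. For a `Z` and the clockwise rotation,
the points below and to the right play these roles. -/
theorem solidCross_counterclockwise_of_slalomSign {e g : Sym2 (Fin n)} (he : e ∈ D.diagonals)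
    (hg : D.IsAccordionDiagonal g) (h : D.slalomSign e g = -1) :
    SolidCross (counterclockwise e) g := by
  obtain ⟨a, b, hab, rfl⟩ := exists_lt_of_not_isDiag hg.1
  obtain ⟨x, hx, rfl⟩ := D.exists_pair_of_slalomSign_ne_zero hab (by rw [h]; norm_num)
  obtain ⟨⟨i, hi, hi'⟩, r, hr, hr'⟩ := (D.slalomSign_eq_neg_one_iff hab hg hx he).1 h
  refine SolidCross.symm ?_
  rw [pairEdge, counterclockwise_mk, solidCross_mk, alternate_iff hab, val_finRotate_symm,
    val_finRotate_symm, val_stepBack]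
  have h1 := (D.mem_pairs.1 hx).1
  have h2 := (D.mem_pairs.1 hi').1
  have h3 := (D.mem_pairs.1 hr').1
  simp only [Admissible, Fin.lt_def, Fin.le_def] at *
  have := x.2.2
  split_ifs <;> omega

theorem solidCross_of_slalomSign {e g : Sym2 (Fin n)} (he : e ∈ D.diagonals)
    (hg : D.IsAccordionDiagonal g) (h : D.slalomSign e g = 1) :
    SolidCross e g := by
  obtain ⟨a, b, hab, rfl⟩ := exists_lt_of_not_isDiag hg.1
  obtain ⟨x, hx, rfl⟩ := D.exists_pair_of_slalomSign_ne_zero hab (by rw [h]; norm_num)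
  obtain ⟨⟨r, hr, hr'⟩, i, hi, hi'⟩ := (D.slalomSign_eq_one_iff hab hg hx he).1 h
  refine SolidCross.symm ?_
  rw [pairEdge, solidCross_mk, alternate_iff hab, val_stepBack]
  have h1 := (D.mem_pairs.1 hx).1
  have h2 := (D.mem_pairs.1 hi').1
  have h3 := (D.mem_pairs.1 hr').1
  simp only [Admissible, Fin.lt_def, Fin.le_def] at *
  have := x.2.2
  split_ifs <;> omega

/-- The upper left corner of the bounding box of the staircase is the diagonal that rotates
counterclockwise onto `s(a, b)`; the lower right corner is the one that rotates clockwise onto it.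
-/
theorem counterclockwise_pairEdge (hab : a < b) :
    counterclockwise (pairEdge a ((firstPair hab).1, (lastPair hab).2)) = s(a, b) := by
  rw [pairEdge, counterclockwise_mk, Sym2.eq_iff]
  refine .inl ⟨?_, ?_⟩ <;> ext <;> rw [val_finRotate_symm]
  · simp [firstPair]
  · simp only [lastPair, val_stepBack]
    split_ifs <;> omega

theorem pairEdge_last_first (hab : a < b) :
    pairEdge a ((lastPair hab).1, (firstPair hab).2) = s(a, b) := by
  refine Sym2.eq_swap.trans (Sym2.congr_left.2 ?_)
  ext
  simp [val_stepBack, firstPair]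

/-- A solid diagonal with a `Z` turn at `e` is the rotation of `e`, or it has an `S` turn at a
diagonal having a common endpoint with `e`. -/
theorem eq_counterclockwise_or_exists_neg {e g : Sym2 (Fin n)} (he : e ∈ D.diagonals)
    (hg : D.IsAccordionDiagonal g) (h : D.slalomSign e g = 1) :
    g = counterclockwise e ∨ ∃ u v w, e = s(u, v) ∧ s(w, v) ∈ D.diagonals ∧
      D.slalomSign s(w, v) g = -1 := by
  obtain ⟨a, b, hab, rfl⟩ := exists_lt_of_not_isDiag hg.1
  obtain ⟨x, hx, rfl⟩ := D.exists_pair_of_slalomSign_ne_zero hab (by rw [h]; norm_num)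
  obtain ⟨hb, hr⟩ := (D.slalomSign_eq_one_iff hab hg hx he).1 h
  have hS := D.isStaircase_pairs hab hg
  by_cases h1 : x.1 = (firstPair hab).1
  · by_cases h2 : x.2 = (lastPair hab).2
    · left
      rw [show x = ((firstPair hab).1, (lastPair hab).2) from Prod.ext h1 h2,
        counterclockwise_pairEdge]
    · right
      obtain ⟨i, hi, hl, ha⟩ := hS.exists_turn_right hx hr h2
      have hD := D.pairEdge_mem_diagonals_of_turn hab hi (.inl hl) (.inr ha)
      exact ⟨x.1, stepBack a x.2, i, rfl, hD,
        (D.slalomSign_eq_neg_one_iff hab hg hi hD).2 ⟨hl, ha⟩⟩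
  · right
    obtain ⟨r, hi, hl, ha⟩ := hS.exists_turn_below hx hb h1
    have hD := D.pairEdge_mem_diagonals_of_turn hab hi (.inl hl) (.inr ha)
    refine ⟨stepBack a x.2, x.1, stepBack a r, Sym2.eq_swap, ?_⟩
    rw [Sym2.eq_swap]
    exact ⟨hD, (D.slalomSign_eq_neg_one_iff hab hg hi hD).2 ⟨hl, ha⟩⟩

/-- An `S` at the lower right corner of the box identifies `g`; anywhere else the staircase needs a
`Z` in the same row or column. -/
theorem eq_or_exists_pos {e g : Sym2 (Fin n)} (he : e ∈ D.diagonals)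
    (hg : D.IsAccordionDiagonal g) (h : D.slalomSign e g = -1) :
    g = e ∨ ∃ f ∈ D.diagonals, D.slalomSign f g = 1 := by
  obtain ⟨a, b, hab, rfl⟩ := exists_lt_of_not_isDiag hg.1
  obtain ⟨x, hx, rfl⟩ := D.exists_pair_of_slalomSign_ne_zero hab (by rw [h]; norm_num)
  obtain ⟨hl, ha⟩ := (D.slalomSign_eq_neg_one_iff hab hg hx he).1 h
  have hS := D.isStaircase_pairs hab hg
  by_cases h1 : x.1 = (lastPair hab).1
  · by_cases h2 : x.2 = (firstPair hab).2
    · left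
      rw [show x = ((lastPair hab).1, (firstPair hab).2) from Prod.ext h1 h2,
        pairEdge_last_first]
    · right
      obtain ⟨i, hi, hr, hb⟩ := hS.exists_turn_left hx hl h2
      have hD := D.pairEdge_mem_diagonals_of_turn hab hi (.inr hb) (.inl hr)
      exact ⟨_, hD, (D.slalomSign_eq_one_iff hab hg hi hD).2 ⟨hb, hr⟩⟩
  · right
    obtain ⟨i, hi, hr, hb⟩ := hS.exists_turn_above hx ha h1
    have hD := D.pairEdge_mem_diagonals_of_turn hab hi (.inr hb) (.inl hr)
    exact ⟨_, hD, (D.slalomSign_eq_one_iff hab hg hi hD).2 ⟨hb, hr⟩⟩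

/-- The vertices `u, v, w` are distinct and met in this cyclic order. -/
def CyclicOrder (u v w : Fin n) : Prop := (u < v ∧ v < w) ∨ (v < w ∧ w < u) ∨ (w < u ∧ u < v)

theorem exists_pair_cases {u v w : Fin n} (huw : u ≠ w) {x y : Fin n × Fin n}
    (hx : Admissible a b x) (hy : Admissible a b y) (hxe : pairEdge a x = s(u, v))
    (hye : pairEdge a y = s(w, v)) :
    (u = x.1 ∧ v = stepBack a x.2 ∧ w = y.1 ∧ x.2 = y.2 ∧ x.1 ≠ y.1) ∨
      (u = stepBack a x.2 ∧ v = x.1 ∧ w = stepBack a y.2 ∧ x.1 = y.1 ∧ x.2 ≠ y.2) := by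
  rw [pairEdge, Sym2.eq_iff] at hxe hye
  rcases hxe with ⟨rfl, rfl⟩ | ⟨rfl, rfl⟩ <;> rcases hye with ⟨rfl, h⟩ | ⟨h, rfl⟩
  · exact .inl ⟨rfl, rfl, rfl, (stepBack_injective a h).symm, huw⟩
  · exact absurd h.symm (stepBack_ne hx hy)
  · exact absurd h (stepBack_ne hy hx)
  · exact .inr ⟨rfl, rfl, rfl, h.symm, fun h => huw (by rw [h])⟩

/-- A `Z` has nothing to its left and nothing above, so another crossed diagonal through `v` is to
its right or below it. Both positions give the same cyclic order; at an `S` the positions, and the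
order, are reversed. -/
theorem cyclicOrder_of_slalomSign_one {u v w : Fin n} {g : Sym2 (Fin n)} (huw : u ≠ w)
    (he : s(u, v) ∈ D.diagonals) (hg : D.IsAccordionDiagonal g)
    (h : D.slalomSign s(u, v) g = 1) (h' : D.slalomSign s(w, v) g ≠ 0) : CyclicOrder u w v := by
  obtain ⟨a, b, hab, rfl⟩ := exists_lt_of_not_isDiag hg.1
  obtain ⟨x, hx, hxe⟩ := D.exists_pair_of_slalomSign_ne_zero hab (h.trans_ne one_ne_zero)
  obtain ⟨y, hy, hye⟩ := D.exists_pair_of_slalomSign_ne_zero hab h'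
  rw [← hxe] at h he
  obtain ⟨hb, hr⟩ := (D.slalomSign_eq_one_iff hab hg hx he).1 h
  have hS := D.isStaircase_pairs hab hg
  have hx' := (D.mem_pairs.1 hx).1
  have hy' := (D.mem_pairs.1 hy).1
  rcases exists_pair_cases huw hx' hy' hxe hye with
    ⟨rfl, rfl, rfl, h2, h1⟩ | ⟨rfl, rfl, rfl, h1, h2⟩
  · have hlt : x.1 < y.1 := (lt_or_gt_of_ne h1).resolve_right fun hlt =>
      hS.not_left_and_below ⟨y.1, hlt, h2 ▸ hy⟩ hb
    simp only [CyclicOrder, Admissible, Fin.lt_def, Fin.le_def, val_stepBack] at *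
    split_ifs <;> omega
  · have hlt : y.2 < x.2 := (lt_or_gt_of_ne h2).resolve_left fun hlt =>
      hS.not_right_and_above hr ⟨y.2, hlt, h1 ▸ hy⟩
    simp only [CyclicOrder, Admissible, Fin.lt_def, Fin.le_def, val_stepBack] at *
    split_ifs <;> omega

theorem cyclicOrder_of_slalomSign_neg_one {u v w : Fin n} {g : Sym2 (Fin n)} (huw : u ≠ w)
    (he : s(u, v) ∈ D.diagonals) (hg : D.IsAccordionDiagonal g)
    (h : D.slalomSign s(u, v) g = -1) (h' : D.slalomSign s(w, v) g ≠ 0) :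
    CyclicOrder w u v := by
  obtain ⟨a, b, hab, rfl⟩ := exists_lt_of_not_isDiag hg.1
  obtain ⟨x, hx, hxe⟩ := D.exists_pair_of_slalomSign_ne_zero hab (by rw [h]; norm_num)
  obtain ⟨y, hy, hye⟩ := D.exists_pair_of_slalomSign_ne_zero hab h'
  rw [← hxe] at h he
  obtain ⟨hl, ha⟩ := (D.slalomSign_eq_neg_one_iff hab hg hx he).1 h
  have hS := D.isStaircase_pairs hab hg
  have hx' := (D.mem_pairs.1 hx).1
  have hy' := (D.mem_pairs.1 hy).1
  rcases exists_pair_cases huw hx' hy' hxe hye with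
    ⟨rfl, rfl, rfl, h2, h1⟩ | ⟨rfl, rfl, rfl, h1, h2⟩
  · have hlt : y.1 < x.1 := (lt_or_gt_of_ne h1).resolve_left fun hlt =>
      hS.not_right_and_above ⟨y.1, hlt, h2 ▸ hy⟩ ha
    simp only [CyclicOrder, Admissible, Fin.lt_def, Fin.le_def, val_stepBack] at *
    split_ifs <;> omega
  · have hlt : x.2 < y.2 := (lt_or_gt_of_ne h2).resolve_right fun hlt =>
      hS.not_left_and_below hl ⟨y.2, hlt, h1 ▸ hy⟩
    simp only [CyclicOrder, Admissible, Fin.lt_def, Fin.le_def, val_stepBack] at *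
    split_ifs <;> omega

/-- If the `g`-vectors of two accordion diagonals are opposite, then they are the two rotations
of a diagonal of the dissection. -/
theorem eq_counterclockwise_of_opposite {e g g' : Sym2 (Fin n)} (he : e ∈ D.diagonals)
    (hg : D.IsAccordionDiagonal g) (hg' : D.IsAccordionDiagonal g')
    (hopp : ∀ f ∈ D.diagonals, D.slalomSign f g = - D.slalomSign f g')
    (h : D.slalomSign e g = 1) : g = counterclockwise e := by
  rcases D.eq_counterclockwise_or_exists_neg he hg h with h1 | ⟨u, v, w, rfl, hw, h1⟩
  · exact h1
  · exfalso
    have huw : u ≠ w := by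
      rintro rfl
      rw [h] at h1
      norm_num at h1
    have e1 := hopp _ he
    have e2 := hopp _ hw
    -- The diagonal `g` has a `Z` at `s(u, v)` where `g'` has an `S`, and both also turn at `s(w,
    -- v)`; they force opposite cyclic orders on `u, v, w`.
    have c1 := D.cyclicOrder_of_slalomSign_one huw he hg h (by rw [h1]; norm_num)
    have c2 := D.cyclicOrder_of_slalomSign_neg_one huw he hg'
      (by linarith) (fun h' => by rw [h', h1] at e2; norm_num at e2)
    simp only [CyclicOrder, Fin.lt_def] at c1 c2
    omega

/-- If all diagonals crossed by `g` meet one of them, `g` is an accordion diagonal. -/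
theorem isAccordionDiagonal_of_meet {e g : Sym2 (Fin n)} (hg : ¬ g.IsDiag)
    (he : e ∈ D.crossed g) (h : ∀ f ∈ D.crossed g, ∃ v, v ∈ e ∧ v ∈ f) :
    D.IsAccordionDiagonal g := by
  refine ⟨hg, fun f hf f' hf' => ?_⟩
  obtain ⟨v, hv, hv'⟩ := h f hf
  exact .tail (.single ⟨hf, he, v, hv', hv⟩) ⟨he, hf', h f' hf'⟩

/-- The hollow diagonal with the same indices sits at the lower right corner of the box, and a chain
through that corner stays in the bottom row and the last column. -/
theorem pairs_clockwise (hab : a < b) (he : s(a, b) ∈ D.diagonals) :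
    ((lastPair hab).1, (firstPair hab).2) ∈ D.pairs a b ∧
    ∀ y ∈ D.pairs a b, y.1 = (lastPair hab).1 ∨ y.2 = (firstPair hab).2 := by
  have hx : ((lastPair hab).1, (firstPair hab).2) ∈ D.pairs a b := by
    refine D.mem_pairs.2 ⟨⟨hab, le_rfl, ?_⟩, .inl (by rwa [pairEdge_last_first])⟩
    simp only [firstPair]
    omega
  refine ⟨hx, fun y hy => ?_⟩
  by_contra! h
  have h1 := lt_of_le_of_ne (D.le_lastPair hab hy).1 h.1
  exact absurd (D.pairs_chain hy hx h1)
    (not_le.2 (lt_of_le_of_ne (D.firstPair_le hab hy).2 h.2.symm))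

theorem pairs_counterclockwise (hab : a < b)
    (he : pairEdge a ((firstPair hab).1, (lastPair hab).2) ∈ D.diagonals) :
    ((firstPair hab).1, (lastPair hab).2) ∈ D.pairs a b ∧
    ∀ y ∈ D.pairs a b, y.1 = (firstPair hab).1 ∨ y.2 = (lastPair hab).2 := by
  have hx : ((firstPair hab).1, (lastPair hab).2) ∈ D.pairs a b :=
    D.mem_pairs.2 ⟨⟨(D.mem_pairs.1 (D.firstPair_mem hab)).1.1,
      (D.mem_pairs.1 (D.firstPair_mem hab)).1.2.1, (D.mem_pairs.1 (D.lastPair_mem hab)).1.2.2⟩,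
      .inl he⟩
  refine ⟨hx, fun y hy => ?_⟩
  by_contra! h
  have h1 := lt_of_le_of_ne (D.firstPair_le hab hy).1 h.1.symm
  exact absurd (D.pairs_chain hx hy h1)
    (not_le.2 (lt_of_le_of_ne (D.le_lastPair hab hy).2 h.2))

theorem isAccordionDiagonal_of_pairs (hab : a < b) {x : Fin n × Fin n} (hx : x ∈ D.pairs a b)
    (h : ∀ y ∈ D.pairs a b, y.1 = x.1 ∨ y.2 = x.2) : D.IsAccordionDiagonal s(a, b) := by
  refine D.isAccordionDiagonal_of_meet (fun h => hab.ne (Sym2.mk_isDiag_iff.1 h))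
    ((D.mem_crossed_iff hab _).2 ⟨x, hx, rfl⟩) fun f hf => ?_
  obtain ⟨y, hy, rfl⟩ := (D.mem_crossed_iff hab _).1 hf
  rcases h y hy with h | h
  · exact ⟨x.1, by simp [pairEdge], by simp [pairEdge, h]⟩
  · exact ⟨stepBack a x.2, by simp [pairEdge], by simp [pairEdge, h]⟩

theorem isAccordionDiagonal_clockwise {e : Sym2 (Fin n)} (he : e ∈ D.diagonals) :
    D.IsAccordionDiagonal e := by
  obtain ⟨a, b, hab, rfl⟩ := exists_lt_of_not_isDiag (D.internal e he).1
  obtain ⟨hx, h⟩ := D.pairs_clockwise hab he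
  exact D.isAccordionDiagonal_of_pairs hab hx h

/-- The staircase follows the bottom row and then the last column; its only turn is the `S` at the
corner. -/
theorem slalomSign_clockwise {e f : Sym2 (Fin n)} (he : e ∈ D.diagonals)
    (hf : f ∈ D.diagonals) [Decidable (f = e)] :
    D.slalomSign f e = if f = e then -1 else 0 := by
  have hacc := D.isAccordionDiagonal_clockwise he
  obtain ⟨a, b, hab, rfl⟩ := exists_lt_of_not_isDiag (D.internal e he).1
  obtain ⟨hx, h⟩ := D.pairs_clockwise hab he
  by_cases hcr : f ∈ D.crossed s(a, b)
  · obtain ⟨y, hy, rfl⟩ := (D.mem_crossed_iff hab f).1 hcr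
    have hy1 := D.ne_firstPair hab hf
    have hle := D.firstPair_le hab hy
    have hle' := D.le_lastPair hab hy
    by_cases hyx : y = ((lastPair hab).1, (firstPair hab).2)
    · have he' : pairEdge a y = s(a, b) := by rw [hyx, pairEdge_last_first]
      rw [if_pos he', D.slalomSign_eq_neg_one_iff hab hacc hy hf]
      refine ⟨⟨(firstPair hab).1, lt_of_le_of_ne hle.1 fun h' => hy1 ?_, ?_⟩,
        (lastPair hab).2, lt_of_le_of_ne hle'.2 fun h' => D.ne_lastPair hab hf ?_, ?_⟩
      · exact Prod.ext h'.symm (by rw [hyx])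
      · rw [hyx]
        exact D.firstPair_mem hab
      · exact Prod.ext (by rw [hyx]) h'
      · rw [hyx]
        exact D.lastPair_mem hab
    · have he' : pairEdge a y ≠ s(a, b) := by
        rw [← pairEdge_last_first hab]
        exact fun h' => hyx (pairEdge_inj (D.mem_pairs.1 hy).1 (D.mem_pairs.1 hx).1 h')
      classical
      rw [if_neg he', D.slalomSign_pairEdge hab hacc hy hf]
      rcases h y hy with h1 | h1
      · have hl : ¬ HasLeft (D.pairs a b) y := by
          rintro ⟨i, hi, hi'⟩
          rcases h _ hi' with h2 | h2
          · exact hi.ne (h2.trans h1.symm)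
          · exact hyx (Prod.ext h1 h2)
        have hr : ¬ HasRight (D.pairs a b) y := by
          rintro ⟨i, hi, hi'⟩
          exact absurd (D.le_lastPair hab hi').1 (not_le.2 (h1 ▸ hi))
        rw [if_neg hl, if_neg hr, sub_zero]
      · have hl : HasLeft (D.pairs a b) y :=
          ⟨(firstPair hab).1, lt_of_le_of_ne hle.1 fun h' => hy1 (Prod.ext h'.symm h1),
            by rw [h1]; exact D.firstPair_mem hab⟩
        have hr : HasRight (D.pairs a b) y :=
          ⟨(lastPair hab).1, lt_of_le_of_ne hle'.1 fun h' => hyx (Prod.ext h' h1),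
            by rw [h1]; exact hx⟩
        rw [if_pos hl, if_pos hr, sub_self]
  · rw [D.slalomSign_of_not_crossed hcr, if_neg]
    rintro rfl
    exact hcr ((D.mem_crossed_iff hab _).2 ⟨_, hx, pairEdge_last_first hab⟩)

theorem exists_counterclockwise_eq {e : Sym2 (Fin n)} (he : e ∈ D.diagonals) :
    ∃ (a b : Fin n) (hab : a < b), counterclockwise e = s(a, b) ∧
      pairEdge a ((firstPair hab).1, (lastPair hab).2) = e := by
  have hd : ¬ (counterclockwise e).IsDiag := by
    have := (D.internal e he).1
    induction e with | _ u v
    rw [counterclockwise_mk, Sym2.mk_isDiag_iff]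
    rw [Sym2.mk_isDiag_iff] at this
    exact fun h => this ((finRotate n).symm.injective h)
  obtain ⟨a, b, hab, h⟩ := exists_lt_of_not_isDiag hd
  exact ⟨a, b, hab, h, counterclockwise_injective ((counterclockwise_pairEdge hab).trans h.symm)⟩

theorem isAccordionDiagonal_counterclockwise {e : Sym2 (Fin n)} (he : e ∈ D.diagonals) :
    D.IsAccordionDiagonal (counterclockwise e) := by
  obtain ⟨a, b, hab, h, rfl⟩ := D.exists_counterclockwise_eq he
  obtain ⟨hx, h'⟩ := D.pairs_counterclockwise hab he
  rw [h]
  exact D.isAccordionDiagonal_of_pairs hab hx h'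

/-- The staircase follows the first column and then the top row; its only turn is the `Z` at the
corner. -/
theorem slalomSign_counterclockwise {e f : Sym2 (Fin n)} (he : e ∈ D.diagonals)
    (hf : f ∈ D.diagonals) [Decidable (f = e)] :
    D.slalomSign f (counterclockwise e) = if f = e then 1 else 0 := by
  have hacc := D.isAccordionDiagonal_counterclockwise he
  obtain ⟨a, b, hab, hc, rfl⟩ := D.exists_counterclockwise_eq he
  obtain ⟨hx, h⟩ := D.pairs_counterclockwise hab he
  rw [hc] at hacc ⊢
  by_cases hcr : f ∈ D.crossed s(a, b)
  · obtain ⟨y, hy, rfl⟩ := (D.mem_crossed_iff hab f).1 hcr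
    have hy1 := D.ne_firstPair hab hf
    have hy2 := D.ne_lastPair hab hf
    have hle := D.firstPair_le hab hy
    have hle' := D.le_lastPair hab hy
    by_cases hyx : y = ((firstPair hab).1, (lastPair hab).2)
    · rw [if_pos (by rw [hyx]), D.slalomSign_eq_one_iff hab hacc hy hf]
      refine ⟨⟨(firstPair hab).2, lt_of_le_of_ne hle.2 fun h' => hy1 ?_, ?_⟩,
        (lastPair hab).1, lt_of_le_of_ne hle'.1 fun h' => hy2 ?_, ?_⟩
      · exact Prod.ext (by rw [hyx]) h'.symm
      · rw [hyx]
        exact D.firstPair_mem hab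
      · exact Prod.ext h' (by rw [hyx])
      · rw [hyx]
        exact D.lastPair_mem hab
    · have he' : pairEdge a y ≠ pairEdge a ((firstPair hab).1, (lastPair hab).2) :=
        fun h' => hyx (pairEdge_inj (D.mem_pairs.1 hy).1 (D.mem_pairs.1 hx).1 h')
      classical
      rw [if_neg he', D.slalomSign_pairEdge hab hacc hy hf]
      rcases h y hy with h1 | h1
      · have hl : ¬ HasLeft (D.pairs a b) y := by
          rintro ⟨i, hi, hi'⟩
          exact absurd (D.firstPair_le hab hi').1 (not_le.2 (h1 ▸ hi))
        have hr : ¬ HasRight (D.pairs a b) y := by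
          rintro ⟨i, hi, hi'⟩
          rcases h _ hi' with h2 | h2
          · exact hi.ne' (h2.trans h1.symm)
          · exact hyx (Prod.ext h1 h2)
        rw [if_neg hl, if_neg hr, sub_zero]
      · have hl : HasLeft (D.pairs a b) y :=
          ⟨(firstPair hab).1, lt_of_le_of_ne hle.1 fun h' => hyx (Prod.ext h'.symm h1),
            by rw [h1]; exact hx⟩
        have hr : HasRight (D.pairs a b) y :=
          ⟨(lastPair hab).1, lt_of_le_of_ne hle'.1 fun h' => hy2 (Prod.ext h' h1),
            by rw [h1]; exact D.lastPair_mem hab⟩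
        rw [if_pos hl, if_pos hr, sub_self]
  · rw [D.slalomSign_of_not_crossed hcr, if_neg]
    rintro rfl
    exact hcr ((D.mem_crossed_iff hab _).2 ⟨_, hx, rfl⟩)

end HollowDissection

/-! ### Facets of polyhedra given by inequalities -/

section Polyhedron

variable {ι K : Type*} [Fintype ι]

/-- The polyhedron cut out by the inequalities `⟪v k, x⟫ ≤ c k`. -/
def polyhedron (v : K → EuclideanSpace ℝ ι) (c : K → ℝ) : Set (EuclideanSpace ℝ ι) :=
  {x | ∀ k, ⟪v k, x⟫ ≤ c k}

/-- The face of a polyhedron cut out by one of its inequalities. -/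
def polyhedronFace (v : K → EuclideanSpace ℝ ι) (c : K → ℝ) (k : K) :
    Set (EuclideanSpace ℝ ι) :=
  polyhedron v c ∩ {x | ⟪v k, x⟫ = c k}

variable {v : K → EuclideanSpace ℝ ι} {c : K → ℝ}

theorem convex_polyhedron (v : K → EuclideanSpace ℝ ι) (c : K → ℝ) :
    Convex ℝ (polyhedron v c) := by
  intro x hx y hy s t hs ht hst k
  rw [inner_add_right, inner_smul_right, inner_smul_right]
  calc s * ⟪v k, x⟫ + t * ⟪v k, y⟫ ≤ s * c k + t * c k :=
        add_le_add (mul_le_mul_of_nonneg_left (hx k) hs) (mul_le_mul_of_nonneg_left (hy k) ht)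
    _ = c k := by rw [← add_mul, hst, one_mul]

/-- Inequalities with zero normal are left out: they may read `0 ≤ 0`, as they do for boundary edges
of the solid polygon, and could not be made strict. -/
theorem isOpen_strict [Finite K] (v : K → EuclideanSpace ℝ ι) (c : K → ℝ) :
    IsOpen {x | ∀ k, v k ≠ 0 → ⟪v k, x⟫ < c k} := by
  have : {x | ∀ k, v k ≠ 0 → ⟪v k, x⟫ < c k} =
      ⋂ k, ⋂ _ : v k ≠ 0, {x | ⟪v k, x⟫ < c k} := by
    ext x
    simp
  rw [this]
  exact isOpen_iInter_of_finite fun k => isOpen_iInter_of_finite fun _ =>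
    isOpen_lt (by fun_prop) continuous_const

theorem strict_subset_polyhedron (h0 : ∀ k, 0 ≤ c k) :
    {x | ∀ k, v k ≠ 0 → ⟪v k, x⟫ < c k} ⊆ polyhedron v c := by
  intro x hx k
  by_cases hk : v k = 0
  · rw [hk, inner_zero_left]
    exact h0 k
  · exact (hx k hk).le

theorem vectorSpan_polyhedron [Finite K] (h0 : ∀ k, 0 ≤ c k) (h1 : ∀ k, v k ≠ 0 → 0 < c k) :
    vectorSpan ℝ (polyhedron v c) = ⊤ := by
  have h : (0 : EuclideanSpace ℝ ι) ∈ {x | ∀ k, v k ≠ 0 → ⟪v k, x⟫ < c k} := fun k hk => by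
    rw [inner_zero_right]
    exact h1 k hk
  have h2 := (isOpen_strict v c).affineSpan_eq_top ⟨0, h⟩
  have h3 : affineSpan ℝ (polyhedron v c) = ⊤ :=
    top_le_iff.1 (h2 ▸ affineSpan_mono ℝ (strict_subset_polyhedron h0))
  rw [← direction_affineSpan, h3, AffineSubspace.direction_top]

theorem finrank_orthogonal_add_one {w : EuclideanSpace ℝ ι} (hw : w ≠ 0) :
    Module.finrank ℝ (ℝ ∙ w)ᗮ + 1 = Module.finrank ℝ (EuclideanSpace ℝ ι) := by
  rw [← Submodule.finrank_add_finrank_orthogonal (ℝ ∙ w), finrank_span_singleton hw, add_comm]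

theorem vectorSpan_le_orthogonal {F : Set (EuclideanSpace ℝ ι)} {w : EuclideanSpace ℝ ι} {a : ℝ}
    (hF : ∀ x ∈ F, ⟪w, x⟫ = a) : vectorSpan ℝ F ≤ (ℝ ∙ w)ᗮ := by
  rw [vectorSpan, Submodule.span_le]
  rintro _ ⟨x, hx, y, hy, rfl⟩
  rw [SetLike.mem_coe, Submodule.mem_orthogonal_singleton_iff_inner_right]
  change ⟪w, x - y⟫ = 0
  rw [inner_sub_right, hF x hx, hF y hy, sub_self]

theorem eq_zero_of_isMaxOn_open {U : Set (EuclideanSpace ℝ ι)} (hU : IsOpen U)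
    {l : StrongDual ℝ (EuclideanSpace ℝ ι)} {z : EuclideanSpace ℝ ι} (hz : z ∈ U)
    (h : ∀ y ∈ U, l y ≤ l z) : l = 0 := by
  have h1 : IsLocalMax l z := Filter.eventually_of_mem (hU.mem_nhds hz) h
  have h2 := h1.fderiv_eq_zero
  rwa [l.fderiv] at h2

/-- A facet of a polyhedron with the origin in its interior is cut out by one of the
inequalities. -/
theorem IsFacet.exists_eq_polyhedronFace [Finite K] (h0 : ∀ k, 0 ≤ c k)
    (h1 : ∀ k, v k ≠ 0 → 0 < c k) {F : Set (EuclideanSpace ℝ ι)}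
    (hF : IsFacet (polyhedron v c) F) :
    ∃ k, v k ≠ 0 ∧ F = polyhedronFace v c k ∧ vectorSpan ℝ F = (ℝ ∙ v k)ᗮ := by
  obtain ⟨hexp, hne, hdim⟩ := hF
  have hconv : Convex ℝ F := hexp.convex (convex_polyhedron v c)
  obtain ⟨l, hl⟩ := hexp hne
  rw [vectorSpan_polyhedron h0 h1, finrank_top] at hdim
  have hsub : F ⊆ polyhedron v c := fun x hx => by
    rw [hl] at hx
    exact hx.1
  have hl0 : l ≠ 0 := by
    rintro rfl
    have : F = polyhedron v c := by
      rw [hl]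
      ext x
      simp
    rw [this, vectorSpan_polyhedron h0 h1, finrank_top] at hdim
    omega
  obtain ⟨k, hk, hFk⟩ : ∃ k, v k ≠ 0 ∧ ∀ x ∈ F, ⟪v k, x⟫ = c k := by
    by_contra! hcon
    have : Fintype K := Fintype.ofFinite K
    classical
    -- If no inequality is tight on all of `F`, repeated midpoints give a point of `F` where all are
    -- strict. It is interior, so the exposing functional would vanish.
    have key : ∀ T : Finset K, ∃ z ∈ F, ∀ k ∈ T, v k ≠ 0 → ⟪v k, z⟫ < c k := by
      intro T
      induction T using Finset.induction_on with
      | empty =>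
        obtain ⟨z, hz⟩ := hne
        exact ⟨z, hz, by simp⟩
      | insert k T _ ih =>
        obtain ⟨z, hz, hzT⟩ := ih
        by_cases hk : v k = 0
        · refine ⟨z, hz, fun j hj hj0 => ?_⟩
          rcases Finset.mem_insert.1 hj with rfl | hj
          · exact absurd hk hj0
          · exact hzT j hj hj0
        · obtain ⟨x, hx, hxk⟩ := hcon k hk
          have hxk := lt_of_le_of_ne (hsub hx k) hxk
          refine ⟨(1 / 2 : ℝ) • z + (1 / 2 : ℝ) • x,
            hconv hz hx (by norm_num) (by norm_num) (by norm_num), fun j hj hj0 => ?_⟩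
          rw [inner_add_right, inner_smul_right, inner_smul_right]
          rcases Finset.mem_insert.1 hj with rfl | hj
          · linarith [hsub hz j]
          · linarith [hzT j hj hj0, hsub hx j]
    obtain ⟨z, hz, hzk⟩ := key Finset.univ
    refine hl0 (eq_zero_of_isMaxOn_open (isOpen_strict v c)
      (fun k hk => hzk k (Finset.mem_univ k) hk) fun y hy => ?_)
    rw [hl] at hz
    exact hz.2 y (strict_subset_polyhedron h0 hy)
  have hspan : vectorSpan ℝ F = (ℝ ∙ v k)ᗮ := by
    refine Submodule.eq_of_le_of_finrank_eq (vectorSpan_le_orthogonal hFk) ?_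
    have := finrank_orthogonal_add_one hk
    omega
  refine ⟨k, hk, Set.Subset.antisymm (fun x hx => ⟨hsub hx, hFk x hx⟩) ?_, hspan⟩
  rintro y ⟨hy, hyk⟩
  obtain ⟨x, hx⟩ := hne
  have hyx : y - x ∈ vectorSpan ℝ F := by
    rw [hspan, Submodule.mem_orthogonal_singleton_iff_inner_right, inner_sub_right, hFk x hx]
    exact sub_eq_zero.2 hyk
  -- The exposing functional is constant on `F`, so it kills the whole hyperplane of directions;
  -- every point of the face of `k` thus maximizes it too.
  have hker : vectorSpan ℝ F ≤ LinearMap.ker (l : EuclideanSpace ℝ ι →ₗ[ℝ] ℝ) := by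
    rw [vectorSpan, Submodule.span_le]
    rintro _ ⟨x, hx, y, hy, rfl⟩
    rw [hl] at hx hy
    simp only [SetLike.mem_coe, LinearMap.mem_ker, vsub_eq_sub, map_sub, sub_eq_zero]
    exact le_antisymm (hy.2 x hx.1) (hx.2 y hy.1)
  have hlyx : l (y - x) = 0 := hker hyx
  rw [map_sub, sub_eq_zero] at hlyx
  rw [hl] at hx ⊢
  exact ⟨hy, fun z hz => hlyx ▸ hx.2 z hz⟩

theorem isFacet_polyhedronFace [Finite K] (h0 : ∀ k, 0 ≤ c k) (h1 : ∀ k, v k ≠ 0 → 0 < c k)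
    {k : K} (hk : v k ≠ 0) (hne : (polyhedronFace v c k).Nonempty)
    (hspan : (ℝ ∙ v k)ᗮ ≤ vectorSpan ℝ (polyhedronFace v c k)) :
    IsFacet (polyhedron v c) (polyhedronFace v c k) := by
  refine ⟨fun _ => ⟨innerSL ℝ (v k), ?_⟩, hne, ?_⟩
  · obtain ⟨z, hz, hzk⟩ := hne
    ext x
    constructor
    · rintro ⟨hx, hxk⟩
      refine ⟨hx, fun y hy => ?_⟩
      rw [innerSL_apply_apply, innerSL_apply_apply, show ⟪v k, x⟫ = c k from hxk]
      exact hy k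
    · rintro ⟨hx, hxk⟩
      have := hxk z hz
      rw [innerSL_apply_apply, innerSL_apply_apply, show ⟪v k, z⟫ = c k from hzk] at this
      exact ⟨hx, le_antisymm (hx k) this⟩
  · rw [le_antisymm (vectorSpan_le_orthogonal fun x hx => hx.2) hspan,
      vectorSpan_polyhedron h0 h1, finrank_top]
    exact finrank_orthogonal_add_one hk

end Polyhedron

/-! ### Facets of the accordiohedron -/

namespace HollowDissection

variable {n : ℕ} (D : HollowDissection n)

theorem gVector_apply (g : Sym2 (Fin n)) (e : D.diagonals) :
    D.gVector g e = D.slalomSign e.1 g := rfl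

theorem inner_gVector (g : Sym2 (Fin n)) (φ : Sym2 (Fin n) → ℝ) :
    ⟪D.gVector g, WithLp.toLp 2 fun e : D.diagonals => φ e⟫ =
      ∑ e ∈ D.diagonals, D.slalomSign e g * φ e := by
  rw [PiLp.inner_apply, ← Finset.sum_coe_sort D.diagonals fun e => D.slalomSign e g * φ e]
  exact Finset.sum_congr rfl fun e _ => mul_comm (φ e) (D.slalomSign e g)

open Classical in
/-- The accordion diagonals. -/
noncomputable def accordions : Finset (Sym2 (Fin n)) :=
  Finset.univ.filter D.IsAccordionDiagonal

theorem mem_accordions {g : Sym2 (Fin n)} : g ∈ D.accordions ↔ D.IsAccordionDiagonal g := by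
  simp [accordions]

theorem height_eq_sum (g : Sym2 (Fin n)) :
    (D.height g : ℝ) = ∑ h ∈ D.accordions, crossNumber h g := by
  classical
  have : {h : Sym2 (Fin n) | D.IsAccordionDiagonal h ∧ SolidCross h g} =
      (D.accordions.filter fun h => SolidCross h g : Finset (Sym2 (Fin n))) := by
    ext h
    simp [mem_accordions]
  rw [height, this, Set.ncard_coe_finset, Finset.card_filter]
  simp only [crossNumber]
  push_cast
  exact Finset.sum_congr rfl fun h _ => by congr

theorem crossNumber_nonneg (h g : Sym2 (Fin n)) : 0 ≤ crossNumber h g := by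
  unfold crossNumber
  split_ifs <;> norm_num

/-- One of the two rotations of `e` is an accordion diagonal crossing `g`. -/
theorem height_pos_of_slalomSign {e g : Sym2 (Fin n)} (he : e ∈ D.diagonals)
    (hg : D.IsAccordionDiagonal g) (h : D.slalomSign e g ≠ 0) : 0 < (D.height g : ℝ) := by
  obtain ⟨f, hf, hfg⟩ : ∃ f, D.IsAccordionDiagonal f ∧ SolidCross f g := by
    rcases D.slalomSign_eq e g with h1 | h1 | h1
    · exact ⟨e, D.isAccordionDiagonal_clockwise he, D.solidCross_of_slalomSign he hg h1⟩
    · exact ⟨_, D.isAccordionDiagonal_counterclockwise he,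
        D.solidCross_counterclockwise_of_slalomSign he hg h1⟩
    · exact absurd h1 h
  rw [height_eq_sum]
  exact Finset.sum_pos' (fun _ _ => crossNumber_nonneg _ _)
    ⟨f, D.mem_accordions.2 hf, by rw [crossNumber, if_pos hfg]; exact one_pos⟩

theorem height_pos {g : Sym2 (Fin n)} (hg : D.IsAccordionDiagonal g) (h : D.gVector g ≠ 0) :
    0 < (D.height g : ℝ) := by
  obtain ⟨e, he⟩ : ∃ e, D.gVector g e ≠ 0 := by
    by_contra! h'
    exact h (PiLp.ext h')
  exact D.height_pos_of_slalomSign e.2 hg he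

/-- If `h` contributes strictly less on the left, the sum of all contributions is smaller by at
least one. -/
theorem sum_add_le_height {g f : Sym2 (Fin n)} {t : ℝ} (F : Sym2 (Fin n) → ℝ)
    (hF : ∀ h, F h ≤ crossNumber h g) (hf : D.IsAccordionDiagonal f)
    (hft : F f + t ≤ crossNumber f g) : (∑ h ∈ D.accordions, F h) + t ≤ D.height g := by
  rw [height_eq_sum, ← Finset.sum_erase_add _ _ (D.mem_accordions.2 hf),
    ← Finset.sum_erase_add (D.accordions) (fun h => crossNumber h g) (D.mem_accordions.2 hf),
    add_assoc]
  exact add_le_add (Finset.sum_le_sum fun h _ => hF h) hft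

/-- Exchanging the two sums reduces inequalities between heights to inequalities for a single
crossing diagonal `h`. -/
theorem sum_slalomSign_mul_height (g : Sym2 (Fin n)) (ρ : Sym2 (Fin n) → Sym2 (Fin n)) :
    ∑ e ∈ D.diagonals, D.slalomSign e g * D.height (ρ e) =
      ∑ h ∈ D.accordions, ∑ e ∈ D.diagonals, D.slalomSign e g * crossNumber h (ρ e) := by
  rw [Finset.sum_comm]
  refine Finset.sum_congr rfl fun e _ => ?_
  rw [height_eq_sum, Finset.mul_sum]

theorem sum_counterclockwise_le {g : Sym2 (Fin n)} (hg : D.IsAccordionDiagonal g) :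
    ∑ e ∈ D.diagonals, D.slalomSign e g * D.height (counterclockwise e) ≤ D.height g := by
  rw [sum_slalomSign_mul_height, height_eq_sum]
  exact Finset.sum_le_sum fun h _ => D.sum_slalomSign_counterclockwise_le hg h

/-- The rotation of `f` crosses `g` but no rotated diagonal of `D`: it contributes 1 on the right
and 0 on the left. -/
theorem sum_counterclockwise_add_one_le {f g : Sym2 (Fin n)} (hf : f ∈ D.diagonals)
    (hg : D.IsAccordionDiagonal g) (h : D.slalomSign f g = -1) :
    (∑ e ∈ D.diagonals, D.slalomSign e g * D.height (counterclockwise e)) + 1 ≤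
      D.height g := by
  rw [sum_slalomSign_mul_height]
  refine D.sum_add_le_height _ (D.sum_slalomSign_counterclockwise_le hg)
    (D.isAccordionDiagonal_counterclockwise hf) ?_
  rw [crossNumber, if_pos (D.solidCross_counterclockwise_of_slalomSign hf hg h),
    Finset.sum_eq_zero fun e he => ?_, zero_add]
  rw [crossNumber, if_neg (D.not_solidCross_counterclockwise hf he), mul_zero]

theorem sum_clockwise_le {g : Sym2 (Fin n)} (hg : D.IsAccordionDiagonal g) :
    ∑ e ∈ D.diagonals, D.slalomSign e g * -(D.height e : ℝ) ≤ D.height g := by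
  have := D.sum_slalomSign_mul_height g id
  simp only [id, mul_neg, Finset.sum_neg_distrib] at this ⊢
  rw [this, height_eq_sum, ← Finset.sum_neg_distrib]
  refine Finset.sum_le_sum fun h _ => le_of_eq_of_le ?_ (D.neg_sum_slalomSign_le hg h)
  simp only [mul_neg, Finset.sum_neg_distrib]

theorem sum_clockwise_add_one_le {f g : Sym2 (Fin n)} (hf : f ∈ D.diagonals)
    (hg : D.IsAccordionDiagonal g) (h : D.slalomSign f g = 1) :
    (∑ e ∈ D.diagonals, D.slalomSign e g * -(D.height e : ℝ)) + 1 ≤ D.height g := by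
  have := D.sum_slalomSign_mul_height g id
  simp only [id, mul_neg, Finset.sum_neg_distrib] at this ⊢
  rw [this, ← Finset.sum_neg_distrib]
  refine D.sum_add_le_height _ (fun h => le_of_eq_of_le ?_ (D.neg_sum_slalomSign_le hg h))
    (D.isAccordionDiagonal_clockwise hf) ?_
  · simp only [mul_neg, Finset.sum_neg_distrib]
  · rw [crossNumber, if_pos (D.solidCross_of_slalomSign hf hg h),
      Finset.sum_eq_zero fun e he => ?_, neg_zero, zero_add]
    rw [crossNumber, if_neg (D.not_solidCross hf he), mul_zero]

theorem accordiohedron_eq : D.accordiohedron =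
    polyhedron (fun g : {g // D.IsAccordionDiagonal g} => D.gVector g)
      (fun g => (D.height g : ℝ)) := by
  ext x
  exact ⟨fun h g => h g.1 g.2, fun h g hg => h ⟨g, hg⟩⟩

theorem accordiohedronFace_eq {g : Sym2 (Fin n)} (hg : D.IsAccordionDiagonal g) :
    D.accordiohedronFace g =
    polyhedronFace (fun g : {g // D.IsAccordionDiagonal g} => D.gVector g)
      (fun g => (D.height g : ℝ)) ⟨g, hg⟩ := by
  rw [accordiohedronFace, accordiohedron_eq]
  rfl

theorem exists_accordiohedronFace_of_isFacet {F : Set (EuclideanSpace ℝ D.diagonals)}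
    (hF : IsFacet D.accordiohedron F) :
    ∃ g, D.IsAccordionDiagonal g ∧ D.gVector g ≠ 0 ∧ F = D.accordiohedronFace g ∧
      vectorSpan ℝ F = (ℝ ∙ D.gVector g)ᗮ := by
  rw [accordiohedron_eq] at hF
  obtain ⟨g, h1, h2, h3⟩ := hF.exists_eq_polyhedronFace (fun g => Nat.cast_nonneg _)
    fun g hg => D.height_pos g.2 hg
  exact ⟨g.1, g.2, h1, by rw [h2, D.accordiohedronFace_eq g.2], h3⟩

/-- A face with a coordinate vector as normal is a facet if it contains a point and all its
translates along the other coordinates. -/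
theorem isFacet_of_translates {g : Sym2 (Fin n)} (hg : D.IsAccordionDiagonal g)
    {e : D.diagonals} (s : ℝ) (hs : s ≠ 0)
    (hge : D.gVector g = EuclideanSpace.single e s)
    {x : EuclideanSpace ℝ D.diagonals} (hx : x ∈ D.accordiohedronFace g) (t : ℝ) (ht : t ≠ 0)
    (h : ∀ f ≠ e, x + t • EuclideanSpace.single f (1 : ℝ) ∈ D.accordiohedron) :
    IsFacet D.accordiohedron (D.accordiohedronFace g) ∧
      vectorSpan ℝ (D.accordiohedronFace g) = (ℝ ∙ EuclideanSpace.single e (1 : ℝ))ᗮ := by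
  have hspan : (ℝ ∙ D.gVector g) = ℝ ∙ EuclideanSpace.single e (1 : ℝ) := by
    have : D.gVector g = s • EuclideanSpace.single e (1 : ℝ) := by
      rw [hge]
      ext f
      simp
    rw [this]
    exact Submodule.span_singleton_smul_eq (IsUnit.mk0 s hs) _
  have hne : D.gVector g ≠ 0 := by
    rw [hge]
    intro h0
    exact hs (by simpa using congrArg (fun y : EuclideanSpace ℝ D.diagonals => y e) h0)
  have hmem : ∀ f ≠ e, x + t • EuclideanSpace.single f (1 : ℝ) ∈ D.accordiohedronFace g := by
    intro f hf
    refine ⟨h f hf, ?_⟩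
    have h1 : ⟪D.gVector g, x⟫ = (D.height g : ℝ) := hx.2
    change ⟪D.gVector g, _⟫ = (D.height g : ℝ)
    rw [inner_add_right, inner_smul_right, h1, hge, EuclideanSpace.inner_single_right]
    simp [hf]
  have hle : (ℝ ∙ D.gVector g)ᗮ ≤ vectorSpan ℝ (D.accordiohedronFace g) := by
    intro w hw
    rw [hspan, Submodule.mem_orthogonal_singleton_iff_inner_right,
      EuclideanSpace.inner_single_left] at hw
    have hw : w e = 0 := by simpa using hw
    have hsum : w = ∑ f, w f • EuclideanSpace.single f (1 : ℝ) := by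
      ext i
      simp [Finset.sum_apply, Pi.single_apply]
    rw [hsum]
    refine Submodule.sum_mem _ fun f _ => ?_
    by_cases hf : f = e
    · rw [hf, hw, zero_smul]
      exact Submodule.zero_mem _
    · have h1 := vsub_mem_vectorSpan ℝ (hmem f hf) hx
      rw [vsub_eq_sub, add_sub_cancel_left] at h1
      have h2 := Submodule.smul_mem _ (w f * t⁻¹) h1
      rwa [smul_smul, mul_assoc, inv_mul_cancel₀ ht, mul_one] at h2
  refine ⟨?_, hspan ▸ le_antisymm (vectorSpan_le_orthogonal fun x hx => hx.2) hle⟩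
  rw [D.accordiohedronFace_eq hg] at hle hx ⊢
  rw [accordiohedron_eq]
  exact isFacet_polyhedronFace (fun g => Nat.cast_nonneg _) (fun g hg => D.height_pos g.2 hg)
    hne ⟨x, hx⟩ hle

theorem gVector_counterclockwise (e : D.diagonals) :
    D.gVector (counterclockwise e.1) = EuclideanSpace.single e (1 : ℝ) := by
  ext f
  rw [gVector_apply, D.slalomSign_counterclockwise e.2 f.2, PiLp.single_apply]
  simp only [Subtype.ext_iff]

theorem gVector_clockwise (e : D.diagonals) :
    D.gVector e.1 = - EuclideanSpace.single e (1 : ℝ) := by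
  ext f
  rw [gVector_apply, D.slalomSign_clockwise e.2 f.2, PiLp.neg_apply,
    PiLp.single_apply, apply_ite Neg.neg, neg_zero]
  simp only [Subtype.ext_iff]

/-- One point lies on the faces of all counterclockwise rotations. Lowering its coordinate `f` by 1
can hurt only inequalities with sign `-1` at `f`, and those have slack 1. -/
theorem isFacet_counterclockwise (e : D.diagonals) :
    IsFacet D.accordiohedron (D.accordiohedronFace (counterclockwise e.1)) ∧
      vectorSpan ℝ (D.accordiohedronFace (counterclockwise e.1)) =
        (ℝ ∙ EuclideanSpace.single e (1 : ℝ))ᗮ := by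
  have hx : ∀ g, ⟪D.gVector g, WithLp.toLp 2 fun f : D.diagonals =>
      (D.height (counterclockwise f.1) : ℝ)⟫ =
      ∑ f ∈ D.diagonals, D.slalomSign f g * D.height (counterclockwise f) := fun g =>
    D.inner_gVector g fun f => (D.height (counterclockwise f) : ℝ)
  refine D.isFacet_of_translates (D.isAccordionDiagonal_counterclockwise e.2) 1 one_ne_zero
    (D.gVector_counterclockwise e) (x := WithLp.toLp 2 fun f : D.diagonals =>
      (D.height (counterclockwise f.1) : ℝ)) ⟨fun g hg => ?_, ?_⟩ (-1) (by norm_num) ?_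
  · exact (hx g).trans_le (D.sum_counterclockwise_le hg)
  · change ⟪_, _⟫ = _
    rw [gVector_counterclockwise, EuclideanSpace.inner_single_left]
    simp
  · intro f _ g hg
    change ⟪_, _⟫ ≤ _
    rw [inner_add_right, inner_smul_right, hx, EuclideanSpace.inner_single_right, gVector_apply]
    have h1 := D.sum_counterclockwise_le hg
    rcases D.slalomSign_eq f.1 g with h | h | h <;> rw [h]
    · simp; linarith
    · have := D.sum_counterclockwise_add_one_le f.2 hg h
      simp; linarith
    · simp; linarith

/-- Here the common point is raised by 1, and the slack is needed where the sign is `1`. -/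
theorem isFacet_clockwise (e : D.diagonals) :
    IsFacet D.accordiohedron (D.accordiohedronFace e.1) ∧
      vectorSpan ℝ (D.accordiohedronFace e.1) = (ℝ ∙ EuclideanSpace.single e (1 : ℝ))ᗮ := by
  have hx : ∀ g, ⟪D.gVector g, WithLp.toLp 2 fun f : D.diagonals => -(D.height f.1 : ℝ)⟫ =
      ∑ f ∈ D.diagonals, D.slalomSign f g * -(D.height f : ℝ) := fun g =>
    D.inner_gVector g fun f => -(D.height f : ℝ)
  refine D.isFacet_of_translates (D.isAccordionDiagonal_clockwise e.2) (-1) (by norm_num)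
    ?_ (x := WithLp.toLp 2 fun f : D.diagonals => -(D.height f.1 : ℝ))
    ⟨fun g hg => ?_, ?_⟩ 1 one_ne_zero ?_
  · rw [gVector_clockwise]
    ext f
    simp [apply_ite]
  · exact (hx g).trans_le (D.sum_clockwise_le hg)
  · change ⟪_, _⟫ = _
    rw [gVector_clockwise, inner_neg_left, EuclideanSpace.inner_single_left]
    simp
  · intro f _ g hg
    change ⟪_, _⟫ ≤ _
    rw [inner_add_right, inner_smul_right, hx, EuclideanSpace.inner_single_right, gVector_apply]
    have h1 := D.sum_clockwise_le hg
    rcases D.slalomSign_eq f.1 g with h | h | h <;> rw [h]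
    · have := D.sum_clockwise_add_one_le f.2 hg h
      simp only [map_one, mul_one]; simp at this ⊢; linarith
    · simp at h1 ⊢; linarith
    · simp at h1 ⊢; linarith

theorem eq_counterclockwise_of_gVector {g : Sym2 (Fin n)} (hg : D.IsAccordionDiagonal g)
    {e : D.diagonals} (h : D.gVector g = EuclideanSpace.single e (1 : ℝ)) :
    g = counterclockwise e.1 := by
  have hs : ∀ f : D.diagonals, D.slalomSign f.1 g = if f = e then 1 else 0 := fun f => by
    rw [← gVector_apply, h]
    simp
  rcases D.eq_counterclockwise_or_exists_neg e.2 hg (by rw [hs, if_pos rfl]) with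
    h | ⟨u, v, w, -, hw, h1⟩
  · exact h
  · have h2 := hs ⟨_, hw⟩
    rw [h1] at h2
    split_ifs at h2 <;> norm_num at h2

theorem eq_of_gVector {g : Sym2 (Fin n)} (hg : D.IsAccordionDiagonal g)
    {e : D.diagonals} (h : D.gVector g = - EuclideanSpace.single e (1 : ℝ)) : g = e.1 := by
  have hs : ∀ f : D.diagonals, D.slalomSign f.1 g = if f = e then -1 else 0 := fun f => by
    rw [← gVector_apply, h]
    simp [apply_ite]
  rcases D.eq_or_exists_pos e.2 hg (by rw [hs, if_pos rfl]) with h | ⟨f, hf, h1⟩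
  · exact h
  · have h2 := hs ⟨_, hf⟩
    rw [h1] at h2
    split_ifs at h2 <;> norm_num at h2

/-- Each of the two inequalities is attained somewhere on the polytope, so with equal normals the
heights agree. -/
theorem accordiohedronFace_congr {g g' : Sym2 (Fin n)} (hg : D.IsAccordionDiagonal g)
    (hg' : D.IsAccordionDiagonal g') (h : D.gVector g = D.gVector g')
    (hne : (D.accordiohedronFace g).Nonempty) (hne' : (D.accordiohedronFace g').Nonempty) :
    D.accordiohedronFace g = D.accordiohedronFace g' := by
  obtain ⟨x, hx, hxg⟩ := hne
  obtain ⟨y, hy, hyg⟩ := hne'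
  have h1 := hx g' hg'
  have h2 := hy g hg
  simp only [halfSpace, hyperplane, Set.mem_ofPred_eq] at h1 h2 hxg hyg
  rw [← h] at h1 hyg
  have : (D.height g : ℝ) = D.height g' := by linarith
  rw [accordiohedronFace, accordiohedronFace, hyperplane, hyperplane, h, this]

/-- Proportional `g`-vectors are equal or opposite. -/
theorem gVector_eq_or_eq_neg {g g' : Sym2 (Fin n)} (hne : D.gVector g ≠ 0)
    (h : (ℝ ∙ D.gVector g) = ℝ ∙ D.gVector g') :
    D.gVector g = D.gVector g' ∨ D.gVector g = - D.gVector g' := by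
  have hmem : D.gVector g ∈ ℝ ∙ D.gVector g' := h ▸ Submodule.mem_span_singleton_self _
  obtain ⟨r, hr⟩ := Submodule.mem_span_singleton.1 hmem
  obtain ⟨e, he⟩ : ∃ e, D.gVector g e ≠ 0 := by
    by_contra! h'
    exact hne (PiLp.ext h')
  have h1 : r * D.slalomSign e.1 g' = D.slalomSign e.1 g := by
    rw [← gVector_apply, ← gVector_apply, ← hr]
    simp
  rw [gVector_apply] at he
  have hr1 : r = 1 ∨ r = -1 := by
    rcases D.slalomSign_eq e.1 g' with h2 | h2 | h2 <;>
    rcases D.slalomSign_eq e.1 g with h3 | h3 | h3 <;> rw [h2, h3] at h1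
    · left; linarith
    · right; linarith
    · exact absurd h3 he
    · right; linarith
    · left; linarith
    · exact absurd h3 he
    · norm_num at h1
    · norm_num at h1
    · exact absurd h3 he
  rcases hr1 with rfl | rfl
  · left; rw [← hr, one_smul]
  · right; rw [← hr, neg_one_smul]

theorem exists_of_opposite {g g' : Sym2 (Fin n)} (hg : D.IsAccordionDiagonal g)
    (hg' : D.IsAccordionDiagonal g') (hne : D.gVector g ≠ 0)
    (h : D.gVector g = - D.gVector g') :
    ∃ e : D.diagonals, (g = counterclockwise e.1 ∧ g' = e.1) ∨
      (g' = counterclockwise e.1 ∧ g = e.1) := by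
  have hs : ∀ f ∈ D.diagonals, D.slalomSign f g = - D.slalomSign f g' := fun f hf => by
    rw [← D.gVector_apply g ⟨f, hf⟩, h]
    rfl
  obtain ⟨e, he⟩ : ∃ e, D.gVector g e ≠ 0 := by
    by_contra! h'
    exact hne (PiLp.ext h')
  rw [gVector_apply] at he
  refine ⟨e, ?_⟩
  rcases D.slalomSign_eq e.1 g with h1 | h1 | h1
  · left
    have h2 := D.eq_counterclockwise_of_opposite e.2 hg hg' hs h1
    refine ⟨h2, D.eq_of_gVector hg' ?_⟩
    rw [← gVector_counterclockwise, ← h2, h, neg_neg]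
  · right
    have h2 := D.eq_counterclockwise_of_opposite e.2 hg' hg
      (fun f hf => by rw [hs f hf, neg_neg]) (by linarith [hs e.1 e.2])
    refine ⟨h2, D.eq_of_gVector hg ?_⟩
    rw [← gVector_counterclockwise, ← h2, h]
  · exact absurd h1 he

/-- The pair of parallel facets of a diagonal of the dissection. -/
def facetPair (e : D.diagonals) : Sym2 (Set (EuclideanSpace ℝ D.diagonals)) :=
  s(D.accordiohedronFace (counterclockwise e.1), D.accordiohedronFace e.1)

theorem facetPair_injective : Function.Injective D.facetPair := by
  intro e f h
  have hspan : (ℝ ∙ EuclideanSpace.single e (1 : ℝ))ᗮ =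
      (ℝ ∙ EuclideanSpace.single f (1 : ℝ))ᗮ := by
    rw [facetPair, facetPair, Sym2.eq_iff] at h
    rcases h with ⟨h, -⟩ | ⟨h, -⟩
    · rw [← (D.isFacet_counterclockwise e).2, ← (D.isFacet_counterclockwise f).2, h]
    · rw [← (D.isFacet_counterclockwise e).2, ← (D.isFacet_clockwise f).2, h]
  by_contra hef
  have h1 : EuclideanSpace.single f (1 : ℝ) ∈ (ℝ ∙ EuclideanSpace.single e (1 : ℝ))ᗮ := by
    rw [Submodule.mem_orthogonal_singleton_iff_inner_right, EuclideanSpace.inner_single_left]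
    simp [hef]
  rw [hspan, Submodule.mem_orthogonal_singleton_iff_inner_right,
    EuclideanSpace.inner_single_left] at h1
  simp at h1

/-- At a common point the coordinate `e` would be both a nonnegative height and minus a positive
one. -/
theorem accordiohedronFace_ne (e : D.diagonals) :
    D.accordiohedronFace (counterclockwise e.1) ≠ D.accordiohedronFace e.1 := by
  intro h
  obtain ⟨x, hx⟩ := (D.isFacet_clockwise e).1.2.1
  have h1 : ⟪D.gVector (counterclockwise e.1), x⟫ = (D.height (counterclockwise e.1) : ℝ) :=
    (h ▸ hx).2
  have h2 : ⟪D.gVector e.1, x⟫ = (D.height e.1 : ℝ) := hx.2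
  have h3 := D.height_pos_of_slalomSign e.2 (D.isAccordionDiagonal_clockwise e.2)
    (by rw [D.slalomSign_clockwise e.2 e.2, if_pos rfl]; norm_num)
  rw [gVector_counterclockwise] at h1
  rw [gVector_clockwise, inner_neg_left, h1] at h2
  have h4 : (0 : ℝ) ≤ D.height (counterclockwise e.1) := Nat.cast_nonneg _
  linarith

theorem parallelFacetPairs_eq : parallelFacetPairs D.accordiohedron = Set.range D.facetPair := by
  ext p
  constructor
  · rintro ⟨F, G, rfl, hFG, hF, hG, hpar⟩
    obtain ⟨g, hg, hg0, rfl, hgs⟩ := D.exists_accordiohedronFace_of_isFacet hF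
    obtain ⟨g', hg', -, rfl, hgs'⟩ := D.exists_accordiohedronFace_of_isFacet hG
    have hdir := hpar.direction_eq
    rw [direction_affineSpan, direction_affineSpan, hgs, hgs'] at hdir
    -- Taking orthogonal complements turns equal directions of facets into equal lines of normals.
    have hspan := congrArg Submodule.orthogonal hdir
    rw [Submodule.orthogonal_orthogonal, Submodule.orthogonal_orthogonal] at hspan
    rcases D.gVector_eq_or_eq_neg hg0 hspan with h | h
    · exact absurd (D.accordiohedronFace_congr hg hg' h hF.2.1 hG.2.1) hFG
    · obtain ⟨e, ⟨rfl, rfl⟩ | ⟨rfl, rfl⟩⟩ := D.exists_of_opposite hg hg' hg0 h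
      · exact ⟨e, rfl⟩
      · exact ⟨e, Sym2.eq_swap⟩
  · rintro ⟨e, rfl⟩
    obtain ⟨h1, h2⟩ := D.isFacet_counterclockwise e
    obtain ⟨h3, h4⟩ := D.isFacet_clockwise e
    refine ⟨_, _, rfl, D.accordiohedronFace_ne e, h1, h3, ?_⟩
    rw [AffineSubspace.affineSpan_parallel_iff_vectorSpan_eq_and_eq_empty_iff_eq_empty]
    exact ⟨h2.trans h4.symm, iff_of_false h1.2.1.ne_empty h3.2.1.ne_empty⟩

end HollowDissection

theorem mainTheorem12 (n : ℕ) (hn : 3 ≤ n) (D : HollowDissection n) :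
    (parallelFacetPairs D.accordiohedron).encard = (D.diagonals.card : ℕ∞) ∧
      parallelFacetPairs D.accordiohedron =
        {p | ∃ (e : D.diagonals) (g g' : Sym2 (Fin n)),
          D.IsAccordionDiagonal g ∧ D.IsAccordionDiagonal g' ∧
          D.gVector g = EuclideanSpace.single e (1 : ℝ) ∧
          D.gVector g' = -EuclideanSpace.single e (1 : ℝ) ∧
          p = s(D.accordiohedronFace g, D.accordiohedronFace g')} := by
  rw [D.parallelFacetPairs_eq]
  constructor
  · rw [← Set.image_univ, D.facetPair_injective.encard_image]
    simp
  · ext p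
    constructor
    · rintro ⟨e, rfl⟩
      exact ⟨e, _, _, D.isAccordionDiagonal_counterclockwise e.2,
        D.isAccordionDiagonal_clockwise e.2, D.gVector_counterclockwise e,
        D.gVector_clockwise e, rfl⟩
    · rintro ⟨e, g, g', hg, hg', hge, hge', rfl⟩
      obtain rfl := D.eq_counterclockwise_of_gVector hg hge
      obtain rfl := D.eq_of_gVector hg' hge'
      exact ⟨e, rfl⟩
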